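/- Let $\Omega$ be a nonempty compact metrizable space of states with its Borel $\sigma$-algebra, and let $Y$ be an uncountable standard Borel space of experimental outcomes. *Original game.* An experiment is a Markov kernel $\lambda(\cdot\mid\omega)$ from $\Omega$ to $Y$. A history is a finite list $h=((\lambda_1,y_1),\dots,(\lambda_k,y_k))$ of experiments run and outcomes observed. An experimentation strategy $\xi$ prescribes at every history either a further experiment or to stop; the prescription depends measurably on the outcomes observed so far, and for some finite $T$ the strategy stops after at most $T$ experiments, whatever the outcomes. Conditionally on the state, outcomes are drawn independently. A terminal history of $\xi$ is a history in which every experiment is the one prescribed by $\xi$ and at which $\xi$ stops. The feasible messages at $h$ are its right truncations, $N(h)=\{\emptyset,h_1,\dots,h_k\}$, where $h_i$ consists of the first $i$ entries of $h$. *Hierarchical alternate game.* A signal is a partition of $\Omega\times[0,1]$ into nonempty Lebesgue measurable sets (that is, sets in the product of the Borel $\sigma$-algebra of $\Omega$ and the Lebesgue $\sigma$-algebra of $[0,1]$); with $\ell$ Lebesgue measure, $\Pr(s\mid\omega)=\ell\{x:(\omega,x)\in s\}$. A refinement-ordered signal sequence is a finite sequence $\psi=(\pi_1,\dots,\pi_t)$,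 $t\ge 0$, of signals such that every element of $\pi_i$ is a union of elements of $\pi_{i+1}$. As a measurability condition, automatic if the partitions are countable, each $\pi_i$ is the family of level sets of a measurable function $q_i:\Omega\times[0,1]\to\mathbb R$ such that, for every $j$, whether the element of $\pi_i$ containing a point $p$ is also an element of $\pi_j$ depends only on whether $q_i(p)$ lies in a certain Borel set. Put $\pi_0=\{\Omega\times[0,1]\}$. The sequence $\psi$ induces the evidence structure $M^\psi(s)=\{\pi_0(s),\pi_1(s),\dots,\pi_t(s)\}$ for $s\in\pi_t$, where $\pi_i(s)$ is the element of $\pi_i$ that includes $s$. *Same disclosure.* Say that $\xi$ and $\psi$ yield the same Sender information structure and feasible messages if there are an injective map $\theta$ from $\pi_t$ to the terminal histories of $\xi$ and a map $\Phi$ from messages of the original game to subsets of $\Omega\times[0,1]$ such that 1. for every measurable set $A$ of outcome lists, the union of the $s\in\pi_t$ for which the list of outcomes of $\theta(s)$ is in $A$ is measurable, and for every $\omega\in\Omega$ its conditional probability given $\omega$ is the probability, given $\omega$, that the outcomes of the terminal history reached under $\xi$ are in $A$; 2. for every $s\in\pi_t$, $\Phi$ maps $N(\theta(s))$ bijectively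 onto $M^\psi(s)$; 3. for all $n,n'\in\bigcup_{s\in\pi_t}N(\theta(s))$, $\Phi(n')\subseteq\Phi(n)$ if and only if $n$ is a right truncation of $n'$ (in particular $\Phi$ is injective on this union). **Proposition.** The original game and the hierarchical alternate game are disclosure equivalent: for every experimentation strategy $\xi$ there is a refinement-ordered signal sequence $\psi$, and for every refinement-ordered signal sequence $\psi$ there is an experimentation strategy $\xi$, such that $\xi$ and $\psi$ yield the same Sender information structure and feasible messages. -/

import Mathlib

open MeasureTheory ProbabilityTheory

noncomputable section

/-! ### The original game: sequential private experimentation -/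

/-- Finite lists of outcomes carry the disjoint-union σ-algebra: a set of lists is measurable iff,
for every `n`, its members of length `n` form a measurable subset of `Fin n → Y`. -/
instance List.outcomeMeasurableSpace {Y : Type*} [MeasurableSpace Y] : MeasurableSpace (List Y) :=
  MeasurableSpace.comap List.equivSigmaTuple inferInstance

/-- A (Blackwell) experiment: a measurable family of probability distributions over the outcome
space `Y`, indexed by the state. -/
abbrev Experiment (Ω Y : Type*) [MeasurableSpace Ω] [MeasurableSpace Y] : Type _ :=
  {κ : Kernel Ω Y // IsMarkovKernel κ}

/-- An experimentation history `((e₁, y₁), …, (eₜ, yₜ))`, earliest experiment first. -/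
abbrev History (Ω Y : Type*) [MeasurableSpace Ω] [MeasurableSpace Y] : Type _ :=
  List (Experiment Ω Y × Y)

section Original

variable {Ω Y : Type*} [MeasurableSpace Ω] [MeasurableSpace Y]

/-- The outcomes recorded in a history. -/
def History.outcomes (h : History Ω Y) : List Y := h.map Prod.snd

/-- Truncation-feasible messages at `h`: the initial segments of `h` (the empty one included). -/
def truncationMessages (h : History Ω Y) : Set (History Ω Y) := {n | n <+: h}

/-- The history generated by the experimentation rule `next` (`none` means "stop") when the
successive outcomes are `l`; outcomes listed after the rule has stopped are ignored. -/
def historyOf (next : History Ω Y → Option (Experiment Ω Y)) (l : List Y) : History Ω Y :=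
  l.foldl (fun h y => (next h).elim h (fun e => h ++ [(e, y)])) []

/-- One round of play in state `ω` after the outcomes `l`: nothing changes if the rule has stopped,
otherwise the prescribed experiment is run and its outcome, drawn (conditionally on the state)
independently of the past, is appended. -/
def roundLaw (next : History Ω Y → Option (Experiment Ω Y)) (ω : Ω) (l : List Y) :
    Measure (List Y) :=
  (next (historyOf next l)).elim (Measure.dirac l) (fun e => (e.1 ω).map (fun y => l ++ [y]))

/-- The law of the list of outcomes after `n` rounds of play in state `ω`. -/
def playLaw (next : History Ω Y → Option (Experiment Ω Y)) (ω : Ω) : ℕ → Measure (List Y)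
  | 0 => Measure.dirac []
  | n + 1 => (playLaw next ω n).bind (roundLaw next ω)

variable (Ω Y) in
/-- A history-dependent (pure) experimentation strategy: at every history it either stops or names
the next experiment.  It runs at most `horizon` experiments whatever their outcomes are, and its
decisions depend measurably on the outcomes observed so far. -/
structure ExperimentationStrategy where
  next : History Ω Y → Option (Experiment Ω Y)
  horizon : ℕ
  stops : ∀ l : List Y, horizon ≤ l.length → next (historyOf next l) = none
  measurableSet_stop : MeasurableSet {l : List Y | next (historyOf next l) = none}
  measurable_round : Measurable (fun p : Ω × List Y => roundLaw next p.1 p.2)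

namespace ExperimentationStrategy

/-- `h` is a terminal history of `ξ`: every experiment in `h` is the one which `ξ` prescribes at the
preceding history, and `ξ` stops at `h`. -/
def IsTerminal (ξ : ExperimentationStrategy Ω Y) (h : History Ω Y) : Prop :=
  (∀ (h' : History Ω Y) (e : Experiment Ω Y) (y : Y), h' ++ [(e, y)] <+: h → ξ.next h' = some e) ∧
    ξ.next h = none

/-- The law, given the state, of the outcomes of the terminal history. -/
def terminalLaw (ξ : ExperimentationStrategy Ω Y) (ω : Ω) : Measure (List Y) :=
  playLaw ξ.next ω ξ.horizon

end ExperimentationStrategy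

end Original

/-! ### The hierarchical alternate game: refinement-ordered signal sequences -/

/-- Lebesgue measure on the σ-algebra of Lebesgue measurable subsets of `[0, 1]`. -/
abbrev lebesgueUnit :
    Measure (NullMeasurableSpace unitInterval (volume : Measure unitInterval)) :=
  (volume : Measure unitInterval).completion

/-- The expanded state space `Ω × [0, 1]`; the second factor carries the σ-algebra of Lebesgue
measurable sets. -/
abbrev Expanded (Ω : Type*) : Type _ :=
  Ω × NullMeasurableSpace unitInterval (volume : Measure unitInterval)

section Alternate

variable {Ω Y : Type*} [MeasurableSpace Ω] [MeasurableSpace Y]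

/-- `Pr(s | ω) = ℓ {x | (ω, x) ∈ s}`. -/
def condProb (s : Set (Expanded Ω)) (ω : Ω) : ENNReal := lebesgueUnit {x | (ω, x) ∈ s}

/-- A signal: a partition of the expanded state space into (nonempty) measurable sets. -/
def IsSignal (π : Set (Set (Expanded Ω))) : Prop :=
  Setoid.IsPartition π ∧ ∀ s ∈ π, MeasurableSet s

/-- `π'` refines the set `s`: `s` is a union of elements of `π'`. -/
def RefinesSet (π' : Set (Set (Expanded Ω))) (s : Set (Expanded Ω)) : Prop :=
  ∃ P : Set (Set (Expanded Ω)), P ⊆ π' ∧ s = ⋃₀ P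

/-- `π'` is a refinement of `π`. -/
def IsRefinement (π' π : Set (Set (Expanded Ω))) : Prop := ∀ s ∈ π, RefinesSet π' s

/-- `q` labels the realizations of `π`: its level sets are the elements of `π`. -/
def IsLabelling (π : Set (Set (Expanded Ω))) (q : Expanded Ω → ℝ) : Prop :=
  ∀ s ∈ π, ∀ p ∈ s, ∀ p', p' ∈ s ↔ q p' = q p

variable (Ω) in
/-- A refinement-ordered signal sequence `(π₁, …, πₜ)`, of any length `t ≥ 0`.

The last field is the measurability that makes signals with uncountably many realizations
meaningful random objects: the realizations of each signal have measurable real labels, and it can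
be told measurably from its label whether a realization of one signal is also a realization of
another one in the sequence.  It holds automatically when the partitions are countable
(`measurable_labels_of_countable`). -/
structure SignalSequence where
  signals : List (Set (Set (Expanded Ω)))
  isSignal : ∀ π ∈ signals, IsSignal π
  refines : signals.IsChain (fun π π' => IsRefinement π' π)
  measurable_labels : ∀ π ∈ signals, ∃ q : Expanded Ω → ℝ, Measurable q ∧ IsLabelling π q ∧
    ∀ π' ∈ signals, ∃ B : Set ℝ, MeasurableSet B ∧ ∀ s ∈ π, ∀ p ∈ s, (q p ∈ B ↔ s ∈ π')

theorem measurable_labels_of_countable (signals : List (Set (Set (Expanded Ω))))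
    (isSignal : ∀ π ∈ signals, IsSignal π) (countable : ∀ π ∈ signals, π.Countable) :
    ∀ π ∈ signals, ∃ q : Expanded Ω → ℝ, Measurable q ∧ IsLabelling π q ∧
      ∀ π' ∈ signals, ∃ B : Set ℝ, MeasurableSet B ∧ ∀ s ∈ π, ∀ p ∈ s, (q p ∈ B ↔ s ∈ π') := by
  intro π hπ
  obtain ⟨hpart, hmeas⟩ := isSignal π hπ
  have hc := countable π hπ
  obtain ⟨e, he⟩ := Set.countable_iff_exists_injOn.mp hc
  choose cell hcell huniq using hpart.2
  have hq : ∀ s ∈ π, ∀ p ∈ s, cell p = s := fun s hs p hp => (huniq p s ⟨hs, hp⟩).symm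
  have hcast : ∀ s ∈ π, ∀ s' ∈ π, ((e s : ℕ) : ℝ) = (e s' : ℕ) → s = s' :=
    fun s hs s' hs' h => he hs hs' (Nat.cast_injective h)
  refine ⟨fun p => ((e (cell p) : ℕ) : ℝ), ?_, ?_, ?_⟩
  · intro A _
    have : (fun p => ((e (cell p) : ℕ) : ℝ)) ⁻¹' A = ⋃₀ {s ∈ π | ((e s : ℕ) : ℝ) ∈ A} := by
      ext p
      simp only [Set.mem_preimage, Set.mem_sUnion, Set.mem_ofPred_eq]
      constructor
      · intro h
        exact ⟨cell p, ⟨(hcell p).1, h⟩, (hcell p).2⟩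
      · rintro ⟨s, ⟨hs, h⟩, hp⟩
        rw [hq s hs p hp]; exact h
    rw [this]
    exact MeasurableSet.sUnion (hc.mono (fun s hs => hs.1)) (fun s hs => hmeas s hs.1)
  · intro s hs p hp p'
    constructor
    · intro hp'
      simp only [hq s hs p hp, hq s hs p' hp']
    · intro h
      have h2 := hcast _ (hcell p').1 _ (hcell p).1 h
      rw [hq s hs p hp] at h2
      rw [← h2]; exact (hcell p').2
  · intro π' _
    refine ⟨(fun s => ((e s : ℕ) : ℝ)) '' {s ∈ π | s ∈ π'},
      ((hc.mono (fun s hs => hs.1)).image _).measurableSet, ?_⟩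
    intro s hs p hp
    simp only [hq s hs p hp]
    constructor
    · rintro ⟨s', ⟨hs', h'⟩, h⟩
      rw [← hcast s' hs' s hs h]; exact h'
    · intro h
      exact ⟨s, ⟨hs, h⟩, rfl⟩

namespace SignalSequence

/-- The last signal `πₜ`; for the empty sequence it is the uninformative one, `{Ω × [0, 1]}`. -/
def last (ψ : SignalSequence Ω) : Set (Set (Expanded Ω)) :=
  ({Set.univ} :: ψ.signals).getLast (List.cons_ne_nil _ _)

/-- The induced evidence structure `M^ψ(s) = {π₀(s), π₁(s), …, πₜ(s)}`, where `π₀ = {Ω × [0, 1]}`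
and `πᵢ(s)` is the element of `πᵢ` that includes `s`.  The message `π₀(s) = Ω × [0, 1]` discloses
nothing. -/
def messages (ψ : SignalSequence Ω) (s : Set (Expanded Ω)) : Set (Set (Expanded Ω)) :=
  {m | s ⊆ m ∧ ∃ π ∈ ({Set.univ} :: ψ.signals : List (Set (Set (Expanded Ω)))), m ∈ π}

end SignalSequence

/-! ### Disclosure equivalence -/

/-- `ξ` and `ψ` give Sender the same information structure and the same message availabilities:
the realizations of the last signal can be identified with terminal histories (`θ`), and the
messages of one game with those of the other (`Φ`), so that
* distinct realizations correspond to distinct terminal histories;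
* in every state, terminal histories and the corresponding realizations have the same law;
* the truncation-feasible messages at a terminal history correspond one to one to the messages
  available to the corresponding realization;
* the correspondence between messages does not depend on the realization, is one to one across
  all feasible messages, and a longer message corresponds to a smaller set. -/
def SameDisclosure (ξ : ExperimentationStrategy Ω Y) (ψ : SignalSequence Ω) : Prop :=
  ∃ (θ : Set (Expanded Ω) → History Ω Y) (Φ : History Ω Y → Set (Expanded Ω)),
    (∀ s ∈ ψ.last, ξ.IsTerminal (θ s)) ∧
    Set.InjOn θ ψ.last ∧
    (∀ A : Set (List Y), MeasurableSet A →
      MeasurableSet (⋃₀ {s ∈ ψ.last | (θ s).outcomes ∈ A}) ∧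
      ∀ ω, ξ.terminalLaw ω A = condProb (⋃₀ {s ∈ ψ.last | (θ s).outcomes ∈ A}) ω) ∧
    (∀ s ∈ ψ.last, Set.BijOn Φ (truncationMessages (θ s)) (ψ.messages s)) ∧
    (∀ s ∈ ψ.last, ∀ s' ∈ ψ.last, ∀ n ∈ truncationMessages (θ s),
      ∀ n' ∈ truncationMessages (θ s'), (Φ n' ⊆ Φ n ↔ n <+: n'))

end Alternate

end

/-! Both games are encoded by one object: a measurable code `F` from `Ω × [0,1]` to finite lists of
outcomes, such that given `ω` the list `F (ω, x)` has the law of the terminal outcomes. A history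
with outcome list `a` corresponds to the cylinder of points whose code starts with `a`; a longer
list gives a smaller cylinder. If all codes are terminal runs, the last signal consists of the
cylinders of full codes, the messages are the cylinders of their prefixes, and distinct prefixes of
a code have distinct cylinders, then the disclosure is the same (`sameDisclosure_of_code`).

From strategy to signals, the terminal law is a kernel, hence the image of Lebesgue measure under a
map measurable in `(ω, x)`. The signals are the partitions by the first `i` entries of the code. Two
prefixes could still have equal cylinders, for instance when an experiment has a deterministic
outcome. So the map is redefined on a null set of `x` in order that every terminal run, even an
impossible one, is attained in every state. Every unfinished prefix then has two different
continuations, which separates the cylinders. The redefinition may be arbitrary because Lebesgue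
measure is complete, and it does not change the law.

From signals to strategy, the code of a point lists the labels of the cells containing it, tagged
with their level, omitting a level whose cell equals the previous one: such a cell is not a new
message. Uncountability of `Y` makes room for the tagged real labels. The experiment after outcomes
`l` draws the next entry from its conditional law given the state and the first entries `l`,
obtained by disintegration (`exists_strategy_of_code`). Stopping is measurable because the last
label tells whether its cell already belongs to the last signal. -/

noncomputable section

/-! ### The measurable space of finite lists. -/

section Lists

variable {Y Z : Type*} [MeasurableSpace Y] [MeasurableSpace Z]

theorem measurable_list_dom {f : List Y → Z}
    (h : ∀ n, Measurable (fun v : Fin n → Y => f (List.ofFn v))) : Measurable f := by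
  have : f = (fun s : Σ n, Fin n → Y => f (List.ofFn s.2)) ∘ List.equivSigmaTuple := by
    funext l; simp [List.equivSigmaTuple]
  rw [this]
  refine Measurable.comp ?_ (comap_measurable _)
  intro A hA
  refine MeasurableSpace.measurableSet_iInf.2 fun n => ?_
  exact h n hA

theorem List.measurable_length : Measurable (List.length : List Y → ℕ) :=
  measurable_list_dom fun n => by simp

theorem List.measurable_getD (i : ℕ) (y : Y) : Measurable (fun l : List Y => l.getD i y) := by
  refine measurable_list_dom fun n => ?_
  by_cases hi : i < n
  · simpa [hi] using measurable_pi_apply (⟨i, hi⟩ : Fin n)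
  · simp [not_lt.1 hi]

theorem measurable_ofFn (n : ℕ) : Measurable (List.ofFn : (Fin n → Y) → List Y) := by
  rintro _ ⟨A, hA, rfl⟩
  have h := MeasurableSpace.measurableSet_iInf.1 hA n
  have : (List.ofFn ⁻¹' (List.equivSigmaTuple ⁻¹' A) : Set (Fin n → Y)) = Sigma.mk n ⁻¹' A := by
    ext v
    have : List.equivSigmaTuple (List.ofFn v) = ⟨n, v⟩ :=
      List.equivSigmaTuple.apply_symm_apply ⟨n, v⟩
    simp [this]
  rw [this]; exact h

/-- Where the length is `n`, the list is rebuilt from its first `n` padded entries, so a preimage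
splits into countably many measurable pieces. -/
theorem measurable_list_cod (y : Y) {f : Z → List Y}
    (hl : Measurable fun z => (f z).length) (hd : ∀ i, Measurable fun z => (f z).getD i y) :
    Measurable f := by
  intro A hA
  have : f ⁻¹' A = ⋃ n, {z | (f z).length = n} ∩
      (fun z => List.ofFn (fun i : Fin n => (f z).getD i y)) ⁻¹' A := by
    ext z
    simp
  rw [this]
  refine MeasurableSet.iUnion fun n => (hl (measurableSet_singleton n)).inter ?_
  exact ((measurable_ofFn n).comp (measurable_pi_lambda _ fun i => hd i)) hA

theorem List.measurable_take (k : ℕ) : Measurable (fun l : List Y => l.take k) := by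
  rcases isEmpty_or_nonempty Y with h | ⟨⟨y⟩⟩
  · have : (fun l : List Y => l.take k) = fun _ => [] := by
      funext l; exact Subsingleton.elim _ _
    rw [this]; exact measurable_const
  refine measurable_list_cod y ?_ fun i => ?_
  · simp only [List.length_take]
    exact measurable_const.min List.measurable_length
  · by_cases hi : i < k
    · simpa [List.getD_eq_getElem?_getD, hi] using List.measurable_getD i y
    · simp [List.getD_eq_getElem?_getD, hi]

theorem List.measurable_concat : Measurable (fun p : List Y × Y => p.1 ++ [p.2]) := by
  rcases isEmpty_or_nonempty Y with h | ⟨⟨y⟩⟩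
  · exact measurable_of_empty _
  refine measurable_list_cod y ?_ fun i => ?_
  · simpa using (List.measurable_length.comp measurable_fst).add_const 1
  · have : (fun p : List Y × Y => (p.1 ++ [p.2]).getD i y) = fun p =>
        if i < p.1.length then p.1.getD i y else if i = p.1.length then p.2 else y := by
      funext p
      split_ifs with h1 h2
      · simp [List.getD_eq_getElem?_getD, List.getElem?_append, h1]
      · simp [List.getD_eq_getElem?_getD, h2]
      · rw [List.getD_eq_default]; simp; omega
    rw [this]
    have hm : Measurable fun p : List Y × Y => p.1.length :=
      List.measurable_length.comp measurable_fst
    exact Measurable.ite (measurableSet_lt measurable_const hm)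
      ((List.measurable_getD i y).comp measurable_fst)
      (Measurable.ite (measurableSet_eq_fun measurable_const hm) measurable_snd measurable_const)

/-- A finite list, padded to a sequence, together with its length. -/
def List.padded (y : Y) (l : List Y) : ℕ × (ℕ → Y) := (l.length, fun i => l.getD i y)

/-- The range consists of the pairs whose sequence equals `y` from the recorded length on, and
truncating at that length is a measurable inverse. This embeds lists in a product of standard Borel
spaces when `Y` is standard Borel. -/
theorem List.measurableEmbedding_padded [MeasurableSingletonClass Y] (y : Y) :
    MeasurableEmbedding (List.padded y) := by
  refine MeasurableEmbedding.of_measurable_inverse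
    (g := fun p => List.ofFn fun i : Fin p.1 => p.2 i) ?_ ?_ ?_ ?_
  · exact List.measurable_length.prodMk (measurable_pi_lambda _ fun i => List.measurable_getD i y)
  · have : Set.range (List.padded y) = ⋂ i : ℕ, {p | p.1 ≤ i}ᶜ ∪ {p | p.2 i = y} := by
      ext ⟨n, f⟩
      simp only [Set.mem_range, Set.mem_iInter, Set.mem_union, Set.mem_compl_iff,
        Set.mem_ofPred_eq]
      constructor
      · rintro ⟨l, hl⟩ i
        simp only [List.padded, Prod.mk.injEq] at hl
        obtain ⟨rfl, rfl⟩ := hl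
        by_cases h : l.length ≤ i
        · right; exact List.getD_eq_default _ _ h
        · left; exact h
      · intro h
        refine ⟨List.ofFn fun i : Fin n => f i, ?_⟩
        simp only [List.padded, List.length_ofFn, Prod.mk.injEq, true_and]
        funext i
        by_cases hi : i < n
        · simp [hi]
        · rw [List.getD_eq_default _ _ (by simpa using hi)]
          exact ((h i).resolve_left (by simpa using hi)).symm
    rw [this]
    refine MeasurableSet.iInter fun i => MeasurableSet.union ?_ ?_
    · exact (measurableSet_le measurable_fst measurable_const).compl
    · exact (measurableSet_singleton y).preimage ((measurable_pi_apply i).comp measurable_snd)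
  · refine measurable_list_cod y ?_ fun i => ?_
    · simpa using measurable_fst
    · have : (fun p : ℕ × (ℕ → Y) => (List.ofFn fun i : Fin p.1 => p.2 i).getD i y) =
          fun p => if i < p.1 then p.2 i else y := by
        funext p
        split_ifs with h
        · simp [h]
        · rw [List.getD_eq_default]; simpa using h
      rw [this]
      exact Measurable.ite (measurableSet_lt measurable_const measurable_fst)
        ((measurable_pi_apply i).comp measurable_snd) measurable_const
  · intro l
    apply List.ext_getElem <;> simp [List.padded]

instance List.instStandardBorelSpace [StandardBorelSpace Y] : StandardBorelSpace (List Y) := by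
  rcases isEmpty_or_nonempty Y with h | ⟨⟨y⟩⟩
  · have : Countable (List Y) := Finite.to_countable
    have : DiscreteMeasurableSpace (List Y) := inferInstance
    infer_instance
  · have he := List.measurableEmbedding_padded y
    have := he.measurableSet_range.standardBorel
    let e : List Y ≃ᵐ Set.range (List.padded y) := he.equivRange
    let := upgradeStandardBorel (Set.range (List.padded y))
    let : TopologicalSpace (List Y) := TopologicalSpace.induced e inferInstance
    refine ⟨⟨this, ?_, ?_⟩⟩
    · constructor
      rw [borel_comap]
      exact e.measurableEmbedding.comap_eq.symm.trans
        (congrArg (MeasurableSpace.comap e) BorelSpace.measurable_eq)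
    · exact (e.toEquiv.toHomeomorphOfIsInducing ⟨rfl⟩).isClosedEmbedding.polishSpace

end Lists

/-! ### Runs of a rule, and the criterion for equal disclosure. -/

section Runs

variable {Ω Y : Type*} [MeasurableSpace Ω] [MeasurableSpace Y]

/-- The rule `next` does not stop before all the outcomes in `l` have been observed. -/
def IsRun (next : History Ω Y → Option (Experiment Ω Y)) (l : List Y) : Prop :=
  ∀ a, a <+: l → a ≠ l → next (historyOf next a) ≠ none

variable {next : History Ω Y → Option (Experiment Ω Y)} {l a : List Y}

theorem historyOf_concat (l : List Y) (y : Y) :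
    historyOf next (l ++ [y]) = (next (historyOf next l)).elim (historyOf next l)
      (fun e => historyOf next l ++ [(e, y)]) := by
  simp [historyOf]

theorem IsRun.of_prefix (h : IsRun next l) (ha : a <+: l) : IsRun next a := by
  intro b hb hne
  refine h b (hb.trans ha) ?_
  rintro rfl
  exact hne (hb.eq_of_length_le ha.length_le)

theorem isRun_nil : IsRun next [] := fun _ h hne => absurd (List.prefix_nil.1 h) hne

theorem isRun_concat {y : Y} :
    IsRun next (l ++ [y]) ↔ IsRun next l ∧ next (historyOf next l) ≠ none := by
  constructor
  · intro h
    exact ⟨h.of_prefix (List.prefix_append _ _), h l (List.prefix_append _ _) (by simp)⟩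
  · rintro ⟨h, hl⟩ a ha hne
    rcases List.prefix_concat_iff.1 ha with rfl | ha
    · exact absurd rfl hne
    · by_cases hal : a = l
      · rwa [hal]
      · exact h a ha hal

theorem historyOf_concat_of_ne_none (hl : next (historyOf next l) ≠ none) (y : Y) :
    ∃ e, next (historyOf next l) = some e ∧
      historyOf next (l ++ [y]) = historyOf next l ++ [(e, y)] := by
  obtain ⟨e, he⟩ := Option.ne_none_iff_exists'.1 hl
  exact ⟨e, he, by simp [historyOf_concat, he]⟩

theorem IsRun.outcomes_historyOf (h : IsRun next l) : (historyOf next l).outcomes = l := by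
  induction l using List.reverseRecOn with
  | nil => rfl
  | append_singleton l y ih =>
    obtain ⟨h1, h2⟩ := isRun_concat.1 h
    obtain ⟨e, -, he⟩ := historyOf_concat_of_ne_none h2 y
    rw [he]
    simp only [History.outcomes, List.map_append, List.map_cons, List.map_nil]
    exact congrArg (· ++ [y]) (ih h1)

/-- Along a run each outcome adds exactly one entry to the history, so truncating the history
amounts to truncating the outcomes. -/
theorem IsRun.prefix_historyOf_iff (h : IsRun next l) {n : History Ω Y} :
    n <+: historyOf next l ↔ ∃ a, a <+: l ∧ historyOf next a = n := by
  induction l using List.reverseRecOn with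
  | nil => simp [historyOf, eq_comm]
  | append_singleton l y ih =>
    obtain ⟨h1, h2⟩ := isRun_concat.1 h
    obtain ⟨e, -, he⟩ := historyOf_concat_of_ne_none h2 y
    simp only [he, List.prefix_concat_iff, ih h1, or_and_right, exists_or, exists_eq_left]
    rw [← he, @eq_comm _ n]

theorem IsRun.isTerminal {ξ : ExperimentationStrategy Ω Y} (h : IsRun ξ.next l)
    (hhalt : ξ.next (historyOf ξ.next l) = none) : ξ.IsTerminal (historyOf ξ.next l) := by
  refine ⟨fun h' e y hpre => ?_, hhalt⟩
  obtain ⟨a, ha, hah⟩ := h.prefix_historyOf_iff.1 hpre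
  have hrun := h.of_prefix ha
  rcases List.eq_nil_or_concat' a with rfl | ⟨b, z, rfl⟩
  · simp [historyOf] at hah
  · obtain ⟨e', he', hb⟩ := historyOf_concat_of_ne_none (isRun_concat.1 hrun).2 z
    rw [hb] at hah
    obtain ⟨rfl, h2⟩ := List.append_inj' hah rfl
    simp only [List.cons.injEq, Prod.mk.injEq, and_true] at h2
    rw [he', h2.1]

theorem IsRun.eq_of_prefix (h : IsRun next l) (ha : a <+: l)
    (hhalt : next (historyOf next a) = none) : a = l := by
  by_contra hne
  exact h a ha hne hhalt

/-- The points whose code starts with `a`. -/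
def codeCylinder {P : Type*} (F : P → List Y) (a : List Y) : Set P := {p | a <+: F p}

/-- A cell of the last signal is sent to the history of the code common to its points, and a history
to the cylinder of its outcomes. A terminal run is never a proper prefix of another run, so the
cylinder of a full code is its level set. -/
theorem sameDisclosure_of_code (ξ : ExperimentationStrategy Ω Y) (ψ : SignalSequence Ω)
    (F : Expanded Ω → List Y) (hF : Measurable F) (hrun : ∀ p, IsRun ξ.next (F p))
    (hhalt : ∀ p, ξ.next (historyOf ξ.next (F p)) = none)
    (hlast : ψ.last = Set.range fun p => codeCylinder F (F p))
    (hmsg : ∀ p, ψ.messages (codeCylinder F (F p)) = codeCylinder F '' {a | a <+: F p})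
    (hinj : ∀ p, Set.InjOn (codeCylinder F) {a | a <+: F p})
    (hlaw : ∀ ω A, MeasurableSet A → ξ.terminalLaw ω A = lebesgueUnit {x | F (ω, x) ∈ A}) :
    SameDisclosure ξ ψ := by
  classical
  have hcyl : ∀ p p', p' ∈ codeCylinder F (F p) → F p' = F p := fun p p' h =>
    ((hrun p').eq_of_prefix h (hhalt p)).symm
  let θ : Set (Expanded Ω) → History Ω Y := fun s =>
    if h : s.Nonempty then historyOf ξ.next (F h.some) else []
  have hθ : ∀ p, θ (codeCylinder F (F p)) = historyOf ξ.next (F p) := by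
    intro p
    have hne : (codeCylinder F (F p)).Nonempty := ⟨p, List.prefix_rfl⟩
    simp only [θ, dif_pos hne]
    rw [hcyl p _ hne.some_mem]
  have hout : ∀ p, (historyOf ξ.next (F p)).outcomes = F p := fun p =>
    (hrun p).outcomes_historyOf
  have hmem : ∀ p n, n ∈ truncationMessages (historyOf ξ.next (F p)) →
      n.outcomes <+: F p ∧ historyOf ξ.next n.outcomes = n := by
    intro p n hn
    obtain ⟨a, ha, rfl⟩ := (hrun p).prefix_historyOf_iff.1 hn
    rw [((hrun p).of_prefix ha).outcomes_historyOf]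
    exact ⟨ha, rfl⟩
  have hunion : ∀ A, ⋃₀ {s ∈ ψ.last | (θ s).outcomes ∈ A} = F ⁻¹' A := by
    intro A
    ext p
    simp only [Set.mem_sUnion, Set.mem_ofPred_eq, hlast, Set.mem_preimage]
    constructor
    · rintro ⟨_, ⟨⟨p', rfl⟩, h⟩, hp⟩
      simp only [hθ, hout] at h
      rwa [hcyl p' p hp]
    · intro h
      exact ⟨_, ⟨⟨p, rfl⟩, by simpa only [hθ, hout] using h⟩, List.prefix_rfl⟩
  refine ⟨θ, fun n => codeCylinder F n.outcomes, ?_, ?_, ?_, ?_, ?_⟩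
  · rw [hlast]
    rintro _ ⟨p, rfl⟩
    simp only [hθ]
    exact (hrun p).isTerminal (hhalt p)
  · rw [hlast]
    rintro _ ⟨p, rfl⟩ _ ⟨p', rfl⟩ h
    simp only [hθ] at h
    have := congrArg History.outcomes h
    rw [hout, hout] at this
    simp only [this]
  · intro A hA
    rw [hunion]
    exact ⟨hF hA, fun ω => hlaw ω A hA⟩
  · rw [hlast]
    rintro _ ⟨p, rfl⟩
    simp only [hθ, hmsg]
    refine ⟨fun n hn => ⟨_, (hmem p n hn).1, rfl⟩, fun n hn n' hn' h => ?_, ?_⟩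
    · have h1 := hmem p n hn
      have h2 := hmem p n' hn'
      rw [← h1.2, ← h2.2, hinj p h1.1 h2.1 h]
    · rintro _ ⟨a, ha, rfl⟩
      refine ⟨historyOf ξ.next a, (hrun p).prefix_historyOf_iff.2 ⟨a, ha, rfl⟩, ?_⟩
      simp only [((hrun p).of_prefix ha).outcomes_historyOf]
  · rw [hlast]
    rintro _ ⟨p, rfl⟩ _ ⟨p', rfl⟩ n hn n' hn'
    simp only [hθ] at hn hn'
    obtain ⟨h1, h2⟩ := hmem p n hn
    obtain ⟨h1', h2'⟩ := hmem p' n' hn'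
    constructor
    -- The inclusion makes both outcome lists prefixes of the same code, hence comparable. In the
    -- wrong order the cylinders coincide, and injectivity on the prefixes of that code makes the
    -- histories equal.
    · intro hsub
      have hn1 : n.outcomes <+: F p' := hsub h1'
      rcases List.prefix_or_prefix_of_prefix hn1 h1' with h | h
      · rw [← h2, ← h2']
        exact ((hrun p').of_prefix h1').prefix_historyOf_iff.2 ⟨_, h, rfl⟩
      · have : codeCylinder F n.outcomes = codeCylinder F n'.outcomes :=
          Set.Subset.antisymm (fun q hq => h.trans hq) hsub
        rw [← h2, ← h2', hinj p' hn1 h1' this]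
    · intro hpre q hq
      have : n.outcomes <+: n'.outcomes := hpre.map Prod.snd
      exact this.trans hq

end Runs

/-! ### Partitions by the first entries of a code. -/

section LevelCells

variable {Ω Y : Type*}

/-- The points whose codes agree with that of `p` in the first `i` places. -/
def levelCell {P : Type*} (F : P → List Y) (i : ℕ) (p : P) : Set P :=
  {p' | (F p').take i = (F p).take i}

theorem levelCell_eq_iff {P : Type*} {F : P → List Y} {i : ℕ} {p p' : P} :
    levelCell F i p' = levelCell F i p ↔ p' ∈ levelCell F i p := by
  refine ⟨fun h => h ▸ rfl, fun h => ?_⟩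
  have : (F p').take i = (F p).take i := h
  simp only [levelCell, this]

theorem isPartition_range_levelCell {P : Type*} (F : P → List Y) (i : ℕ) :
    Setoid.IsPartition (Set.range (levelCell F i)) := by
  constructor
  · rintro ⟨p, hp⟩
    exact Set.notMem_empty p (hp ▸ (rfl : p ∈ levelCell F i p))
  · intro p
    refine ⟨levelCell F i p, ⟨⟨p, rfl⟩, rfl⟩, ?_⟩
    rintro _ ⟨⟨p', rfl⟩, hp⟩
    exact (levelCell_eq_iff.2 hp).symm

theorem levelCell_anti {P : Type*} (F : P → List Y) {i j : ℕ} (h : i ≤ j) (p : P) :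
    levelCell F j p ⊆ levelCell F i p := by
  intro p' hp'
  have := congrArg (List.take i) (show (F p').take j = (F p).take j from hp')
  simpa [List.take_take, h, levelCell] using this

theorem isRefinement_range_levelCell (F : Expanded Ω → List Y) {i j : ℕ} (h : i ≤ j) :
    IsRefinement (Set.range (levelCell F j)) (Set.range (levelCell F i)) := by
  rintro _ ⟨p, rfl⟩
  refine ⟨levelCell F j '' levelCell F i p, Set.image_subset_range _ _, ?_⟩
  ext p'
  simp only [Set.mem_sUnion, Set.mem_image, exists_exists_and_eq_and]
  constructor
  · exact fun hp' => ⟨p', hp', rfl⟩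
  · rintro ⟨q, hq, hp'⟩
    exact (levelCell_anti F h q hp').trans hq

end LevelCells

/-! ### From a code to a signal sequence. -/

section CodeSignals

variable {Ω Y : Type*} [MeasurableSpace Ω] [MeasurableSpace Y]

/-- `S` plays the role of the stopping set: a prefix of a code lies in it only when complete. The
branching hypothesis `hsplit` is what separates the cylinders of distinct prefixes. -/
theorem exists_signalSequence_of_code [StandardBorelSpace Y] [Nonempty Ω]
    (F : Expanded Ω → List Y) (hF : Measurable F) (T : ℕ)
    (hT : ∀ p, (F p).length ≤ T) (S : Set (List Y)) (hS : MeasurableSet S)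
    (hhalt : ∀ p, F p ∈ S) (hrun : ∀ p a, a <+: F p → a ∈ S → a = F p)
    (hsplit : ∀ p a, a <+: F p → a ∉ S → ∃ p₁ p₂ y₁ y₂, y₁ ≠ y₂ ∧ a ++ [y₁] <+: F p₁ ∧
      a ++ [y₂] <+: F p₂) :
    (∀ p, Set.InjOn (codeCylinder F) {a | a <+: F p}) ∧
    ∃ ψ : SignalSequence Ω, ψ.last = (Set.range fun p => codeCylinder F (F p)) ∧
      ∀ p, ψ.messages (codeCylinder F (F p)) = codeCylinder F '' {a | a <+: F p} := by
  have hinj : ∀ p, Set.InjOn (codeCylinder F) {a | a <+: F p} := by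
    intro p
    -- If `a` were strictly shorter than `b` with the same cylinder, every code through `a` would
    -- continue as `b` does, against the two different continuations of `a`.
    have key : ∀ a b, a <+: F p → b <+: F p → codeCylinder F a = codeCylinder F b →
        a.length ≤ b.length → a = b := by
      intro a b ha hb hab hle
      by_contra hne
      have hpre := List.prefix_of_prefix_length_le ha hb hle
      have hlt : a.length < b.length := lt_of_le_of_ne hle fun h => hne (hpre.eq_of_length h)
      have haS : a ∉ S := fun h => hne
        (hpre.eq_of_length_le ((hrun p a ha h).symm ▸ hb.length_le))
      obtain ⟨p₁, p₂, y₁, y₂, hy, h₁, h₂⟩ := hsplit p a ha haS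
      have hb₁ : b <+: F p₁ := hab.subset ((List.prefix_append _ _).trans h₁)
      have hb₂ : b <+: F p₂ := hab.subset ((List.prefix_append _ _).trans h₂)
      have h₁' := List.prefix_of_prefix_length_le h₁ hb₁ (by simpa using hlt)
      have h₂' := List.prefix_of_prefix_length_le h₂ hb₂ (by simpa using hlt)
      have := (List.prefix_of_prefix_length_le h₁' h₂' (by simp)).eq_of_length (by simp)
      simp only [List.append_cancel_left_eq, List.cons.injEq, and_true] at this
      exact hy this
    intro a ha b hb hab
    rcases le_total a.length b.length with h | h
    · exact key a b ha hb hab h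
    · exact (key b a hb ha hab.symm h).symm
  refine ⟨hinj, ?_⟩
  have hcell : ∀ i p, levelCell F i p = codeCylinder F ((F p).take i) := by
    intro i p
    ext p'
    constructor
    · intro h
      rw [← show (F p').take i = (F p).take i from h]
      exact List.take_prefix _ _
    · intro h
      rcases le_total i (F p).length with hi | hi
      · have := List.prefix_iff_eq_take.1 (show (F p).take i <+: F p' from h)
        rw [List.length_take, min_eq_left hi] at this
        exact this.symm
      · have h' : (F p).take i <+: F p' := h
        rw [List.take_of_length_le hi] at h'
        have := hrun p' _ h' (hhalt p)
        simp only [levelCell, Set.mem_ofPred_eq, this]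
  have hmem : ∀ i j p, levelCell F i p ∈ Set.range (levelCell F j) ↔
      (F p).take i = (F p).take j := by
    intro i j p
    constructor
    · rintro ⟨p', h⟩
      have hp : p ∈ levelCell F j p' := h ▸ (rfl : p ∈ levelCell F i p)
      rw [← levelCell_eq_iff.2 hp, hcell, hcell] at h
      exact (hinj p (List.take_prefix _ _) (List.take_prefix _ _) h).symm
    · intro h
      exact ⟨p, by rw [hcell, hcell, h]⟩
  obtain ⟨e, he⟩ := exists_measurableEmbedding_real (List Y)
  let level : ℕ → Set (Set (Expanded Ω)) := fun i => Set.range (levelCell F i)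
  have hmeas : ∀ i, Measurable fun p => (F p).take i := fun i => (List.measurable_take i).comp hF
  let ψ : SignalSequence Ω :=
    { signals := (List.range T).map fun i => level (i + 1)
      isSignal := by
        intro π hπ
        obtain ⟨i, -, rfl⟩ := List.mem_map.1 hπ
        refine ⟨isPartition_range_levelCell F _, ?_⟩
        rintro _ ⟨p, rfl⟩
        exact hmeas _ (measurableSet_singleton ((F p).take (i + 1)))
      refines := by
        refine List.Pairwise.isChain ?_
        rw [List.pairwise_map]
        exact (List.pairwise_lt_range (n := T)).imp fun h =>
          isRefinement_range_levelCell F (by omega)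
      measurable_labels := by
        intro π hπ
        obtain ⟨i, -, rfl⟩ := List.mem_map.1 hπ
        refine ⟨fun p => e ((F p).take (i + 1)), he.measurable.comp (hmeas _), ?_, ?_⟩
        · rintro _ ⟨q, rfl⟩ p hp p'
          rw [he.injective.eq_iff, ← levelCell_eq_iff.2 hp]
          rfl
        · intro π' hπ'
          obtain ⟨j, -, rfl⟩ := List.mem_map.1 hπ'
          -- The cells at levels `i + 1` and `j + 1` agree iff the two truncations do. For `i < j`
          -- this means that the shorter truncation is already the full code; otherwise, that the
          -- longer one has at most `j + 1` entries.
          refine ⟨e '' (if i < j then S else {l | l.length ≤ j + 1}),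
            he.measurableSet_image.2 ?_, ?_⟩
          · split_ifs
            · exact hS
            · exact measurableSet_le List.measurable_length measurable_const
          · rintro _ ⟨q, rfl⟩ p hp
            rw [he.injective.mem_set_image, ← levelCell_eq_iff.2 hp]
            change _ ↔ levelCell F (i + 1) p ∈ Set.range (levelCell F (j + 1))
            rw [hmem]
            split_ifs with hij
            · constructor
              · intro h
                have hp := hrun p _ (List.take_prefix _ _) h
                have hlen := congrArg List.length hp
                rw [List.length_take] at hlen
                rw [List.take_of_length_le (by omega), List.take_of_length_le (by omega)]
              · intro h
                have hlen := congrArg List.length h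
                simp only [List.length_take] at hlen
                rw [List.take_of_length_le (by omega)]
                exact hhalt p
            · simp only [Set.mem_ofPred_eq, List.length_take]
              constructor
              · intro h
                rcases le_or_gt (F p).length (j + 1) with hl | hl
                · rw [List.take_of_length_le (by omega), List.take_of_length_le (by omega)]
                · rw [show i = j by omega]
              · intro h
                have hlen := congrArg List.length h
                simp only [List.length_take] at hlen
                omega }
  have hlevels : ({Set.univ} :: ψ.signals : List (Set (Set (Expanded Ω)))) =
      (List.range (T + 1)).map level := by
    rw [List.range_succ_eq_map, List.map_cons, List.map_map]
    congr 1
    have : levelCell F 0 = fun _ => Set.univ := by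
      funext p; simp [levelCell]
    have hne : Nonempty (Expanded Ω) := ⟨(Classical.arbitrary Ω, (0 : unitInterval))⟩
    simp only [level, this, Set.range_const]
  refine ⟨ψ, ?_, fun p => ?_⟩
  · have : ψ.last = level T := by
      have h := List.getLast?_eq_some_getLast
        (List.cons_ne_nil ({Set.univ} : Set (Set (Expanded Ω))) ψ.signals)
      have h' := congrArg List.getLast? hlevels
      rw [h, List.range_succ, List.map_append] at h'
      simpa [SignalSequence.last] using h'
    rw [this]
    refine congrArg Set.range ?_
    funext p
    rw [hcell, List.take_of_length_le (hT p)]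
  · ext m
    simp only [SignalSequence.messages, hlevels, List.mem_map, List.mem_range, Set.mem_ofPred_eq,
      Set.mem_image]
    constructor
    · rintro ⟨hsub, _, ⟨i, hi, rfl⟩, p', rfl⟩
      refine ⟨(F p).take i, List.take_prefix _ _, ?_⟩
      rw [← hcell, levelCell_eq_iff.2 (hsub (List.prefix_rfl (l := F p)))]
    · rintro ⟨a, ha, rfl⟩
      refine ⟨fun q hq => ha.trans hq, _, ⟨a.length, ?_, rfl⟩, p, ?_⟩
      · have := ha.length_le.trans (hT p); omega
      · rw [hcell, ← List.prefix_iff_eq_take.1 ha]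

end CodeSignals

/-! ### A null set large enough to enumerate a standard Borel space. -/

section CantorSet

/-- The set is the union of two copies of itself scaled by `1/3`, so its finite measure `v`
satisfies `v ≤ 2v/3`. -/
theorem volume_cantorSet : volume cantorSet = 0 := by
  set v := volume cantorSet with hv
  have hfin : v ≠ ⊤ := (isCompact_cantorSet.measure_lt_top).ne
  have h1 : volume ((fun x : ℝ => x / 3) '' cantorSet) = ENNReal.ofReal 3⁻¹ * v := by
    have := Measure.addHaar_image_homothety (volume : Measure ℝ) 0 3⁻¹ cantorSet
    simp only [Module.finrank_self, pow_one] at this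
    rw [abs_of_pos (by norm_num)] at this
    rw [← this]
    congr 1
    refine Set.image_congr fun x _ => ?_
    simp [AffineMap.homothety_apply, div_eq_inv_mul]
  have h2 : volume ((fun x : ℝ => (2 + x) / 3) '' cantorSet) = ENNReal.ofReal 3⁻¹ * v := by
    rw [← h1, show (fun x : ℝ => (2 + x) / 3) = (fun x => 2 / 3 + x) ∘ fun x => x / 3 by
      funext x; simp only [Function.comp]; ring, Set.image_comp, Set.image_add_left,
      measure_preimage_add]
  have hle : v ≤ ENNReal.ofReal 3⁻¹ * v + ENNReal.ofReal 3⁻¹ * v := by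
    conv_lhs => rw [hv, cantorSet_eq_union_halves]
    exact (measure_union_le _ _).trans_eq (by rw [h1, h2])
  have hreal := ENNReal.toReal_mono (by finiteness) hle
  rw [ENNReal.toReal_add (by finiteness) (by finiteness), ENNReal.toReal_mul,
    ENNReal.toReal_ofReal (by norm_num)] at hreal
  have h0 : v.toReal = 0 := le_antisymm (by linarith) ENNReal.toReal_nonneg
  exact ((ENNReal.toReal_eq_zero_iff v).1 h0).resolve_right hfin

/-- A nonempty standard Borel space is the image of a null set of `[0, 1]`. -/
theorem exists_null_surjOn (β : Type*) [MeasurableSpace β] [StandardBorelSpace β] [Nonempty β] :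
    ∃ (C : Set unitInterval) (g : unitInterval → β),
      (volume : Measure unitInterval) C = 0 ∧ ∀ b, ∃ x ∈ C, g x = b := by
  obtain ⟨e, he⟩ := exists_measurableEmbedding_real β
  -- A mere bijection suffices: no measurability of `g` is claimed.
  have hcard : Nonempty (ℝ ≃ (ℕ → Bool)) := Cardinal.eq.1 (by simp [Cardinal.mk_real])
  obtain ⟨f⟩ := hcard
  let i : β → cantorSet := fun b => cantorSetEquivNatToBool.symm (f (e b))
  have hi : Function.Injective i :=
    cantorSetEquivNatToBool.symm.injective.comp (f.injective.comp he.injective)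
  let j : β → unitInterval := fun b => ⟨i b, cantorSet_subset_unitInterval (i b).2⟩
  have hj : Function.Injective j := fun a b h =>
    hi (Subtype.ext (congrArg (fun x : unitInterval => (x : ℝ)) h))
  refine ⟨Subtype.val ⁻¹' cantorSet, Function.invFun j, ?_, fun b =>
    ⟨j b, (i b).2, Function.leftInverse_invFun hj b⟩⟩
  rw [unitInterval.measurePreserving_coe.measure_preimage_emb unitInterval.measurableEmbedding_coe]
  exact Measure.absolutelyContinuous_of_le Measure.restrict_le_self volume_cantorSet

end CantorSet

/-! ### The law of play. -/

section PlayLaw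

variable {Ω Y : Type*} [MeasurableSpace Ω] [MeasurableSpace Y]
  {next : History Ω Y → Option (Experiment Ω Y)}

theorem measurable_concat_right (l : List Y) : Measurable fun y : Y => l ++ [y] :=
  List.measurable_concat.comp measurable_prodMk_left

theorem roundLaw_of_eq_none {ω : Ω} {l : List Y} (h : next (historyOf next l) = none) :
    roundLaw next ω l = Measure.dirac l := by
  simp [roundLaw, h]

theorem roundLaw_of_eq_some {ω : Ω} {l : List Y} {e : Experiment Ω Y}
    (h : next (historyOf next l) = some e) :
    roundLaw next ω l = (e.1 ω).map fun y => l ++ [y] := by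
  simp [roundLaw, h]

instance isProbabilityMeasure_roundLaw (ω : Ω) (l : List Y) :
    IsProbabilityMeasure (roundLaw next ω l) := by
  rcases h : next (historyOf next l) with _ | e
  · rw [roundLaw_of_eq_none h]; infer_instance
  · have := e.2
    rw [roundLaw_of_eq_some h]
    exact Measure.isProbabilityMeasure_map (measurable_concat_right l).aemeasurable

variable (hround : Measurable fun p : Ω × List Y => roundLaw next p.1 p.2)
include hround

theorem playLaw_succ_apply (ω : Ω) (n : ℕ) {A : Set (List Y)} (hA : MeasurableSet A) :
    playLaw next ω (n + 1) A = ∫⁻ l, roundLaw next ω l A ∂playLaw next ω n :=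
  Measure.bind_apply hA (hround.comp measurable_prodMk_left).aemeasurable

theorem isProbabilityMeasure_playLaw (ω : Ω) (n : ℕ) :
    IsProbabilityMeasure (playLaw next ω n) := by
  induction n with
  | zero => rw [playLaw]; infer_instance
  | succ n ih =>
    refine ⟨?_⟩
    rw [playLaw_succ_apply hround ω n MeasurableSet.univ]
    simp

theorem measurable_playLaw (n : ℕ) : Measurable fun ω => playLaw next ω n := by
  induction n with
  | zero => exact measurable_const
  | succ n ih =>
    refine Measure.measurable_of_measurable_coe _ fun A hA => ?_
    simp only [playLaw_succ_apply hround _ n hA]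
    let κ : Kernel Ω (List Y) := ⟨fun ω => playLaw next ω n, ih⟩
    have : IsMarkovKernel κ := ⟨fun ω => isProbabilityMeasure_playLaw hround ω n⟩
    exact Measurable.lintegral_kernel_prod_right' (κ := κ)
      ((Measure.measurable_coe hA).comp hround)

omit hround in
theorem measurableSet_isRun (hhalt : MeasurableSet {l : List Y | next (historyOf next l) = none}) :
    MeasurableSet {l : List Y | IsRun next l} := by
  have : {l : List Y | IsRun next l} = ⋂ i, {l : List Y | l.length ≤ i} ∪
      (List.take i) ⁻¹' {l : List Y | next (historyOf next l) = none}ᶜ := by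
    ext l
    simp only [Set.mem_ofPred_eq, Set.mem_iInter, Set.mem_union, Set.mem_preimage,
      Set.mem_compl_iff]
    constructor
    · intro h i
      refine or_iff_not_imp_left.2 fun hi => h _ (List.take_prefix _ _) fun he => hi ?_
      rw [← List.take_eq_self_iff]; exact he
    · intro h a ha hne
      have h' := h a.length
      rw [← List.prefix_iff_eq_take.1 ha] at h'
      exact h'.resolve_left fun hl => hne (ha.eq_of_length_le hl)
  rw [this]
  exact MeasurableSet.iInter fun i =>
    (measurableSet_le List.measurable_length measurable_const).union
      (List.measurable_take i hhalt.compl)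

/-- A round either leaves a stopped list unchanged or adds one outcome to a list still in play. At
the horizon this puts the terminal law on terminal runs. -/
theorem ae_playLaw (hhalt : MeasurableSet {l : List Y | next (historyOf next l) = none})
    (ω : Ω) (n : ℕ) : ∀ᵐ l ∂playLaw next ω n,
      IsRun next l ∧ (next (historyOf next l) = none ∨ l.length = n) := by
  have hmeas : ∀ n : ℕ, MeasurableSet {l : List Y | IsRun next l ∧
      (next (historyOf next l) = none ∨ l.length = n)} := fun n =>
    (measurableSet_isRun hhalt).inter
      (hhalt.union (measurableSet_eq_fun List.measurable_length measurable_const))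
  induction n with
  | zero =>
    rw [playLaw, ae_dirac_iff (hmeas 0)]
    exact ⟨isRun_nil, Or.inr rfl⟩
  | succ n ih =>
    rw [ae_iff, ← Set.compl_ofPred, playLaw_succ_apply hround ω n (hmeas _).compl]
    refine lintegral_eq_zero_of_ae_eq_zero ?_
    filter_upwards [ih] with l hl
    rcases h : next (historyOf next l) with _ | e
    · rw [roundLaw_of_eq_none h, Measure.dirac_apply' _ (hmeas _).compl]
      simp [hl.1, h]
    · rw [roundLaw_of_eq_some h, Measure.map_apply (measurable_concat_right l) (hmeas _).compl]
      have hlen : l.length = n := hl.2.resolve_left (by simp [h])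
      have : ∀ y, IsRun next (l ++ [y]) := fun y => isRun_concat.2 ⟨hl.1, by simp [h]⟩
      refine Eq.trans ?_ (measure_empty (μ := e.1 ω))
      congr 1
      ext y
      simp [this, hlen]

end PlayLaw

/-! ### From a strategy to a code, and to signals. -/

section Code

variable {Ω Y : Type*} [MeasurableSpace Ω] [MeasurableSpace Y]

namespace ExperimentationStrategy

/-- The lists of outcomes of the terminal histories. -/
def terminalRuns (ξ : ExperimentationStrategy Ω Y) : Set (List Y) :=
  {l | IsRun ξ.next l ∧ ξ.next (historyOf ξ.next l) = none}

variable (ξ : ExperimentationStrategy Ω Y)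

theorem measurableSet_terminalRuns : MeasurableSet ξ.terminalRuns :=
  (measurableSet_isRun (measurableSet_stop ξ)).inter (measurableSet_stop ξ)

theorem ae_terminalLaw (ω : Ω) : ∀ᵐ l ∂ξ.terminalLaw ω, l ∈ ξ.terminalRuns := by
  filter_upwards [ae_playLaw ξ.measurable_round (measurableSet_stop ξ) ω ξ.horizon] with l hl
  exact ⟨hl.1, hl.2.elim id fun h => ξ.stops l h.ge⟩

theorem length_le_of_isRun {l : List Y} (h : IsRun ξ.next l) : l.length ≤ ξ.horizon := by
  by_contra! hlt
  have hlen : (l.take ξ.horizon).length = ξ.horizon := by simp [hlt.le]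
  refine h (l.take ξ.horizon) (List.take_prefix _ _) (fun he => ?_) (ξ.stops _ hlen.ge)
  rw [he] at hlen; omega

/-- Append arbitrary outcomes until the rule stops, at the latest at the horizon. -/
theorem exists_terminalRuns_extension [Nonempty Y] {l : List Y} (h : IsRun ξ.next l) :
    ∃ d ∈ ξ.terminalRuns, l <+: d := by
  induction hk : ξ.horizon - l.length generalizing l with
  | zero => exact ⟨l, ⟨h, ξ.stops l (by omega)⟩, List.prefix_rfl⟩
  | succ k ih =>
    by_cases hs : ξ.next (historyOf ξ.next l) = none
    · exact ⟨l, ⟨h, hs⟩, List.prefix_rfl⟩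
    · obtain ⟨d, hd, hpre⟩ := ih (l := l ++ [Classical.arbitrary Y])
        (isRun_concat.2 ⟨h, hs⟩) (by simp; omega)
      exact ⟨d, hd, (List.prefix_append _ _).trans hpre⟩

end ExperimentationStrategy

theorem lebesgueUnit_apply (s : Set unitInterval) :
    lebesgueUnit s = (volume : Measure unitInterval) s :=
  Measure.completion_apply _ _

theorem measurable_of_nullMeasurableSpace {β : Type*} [MeasurableSpace β]
    {f : unitInterval → β} (hf : Measurable f) :
    Measurable (fun x : NullMeasurableSpace unitInterval (volume : Measure unitInterval) => f x) :=
  fun _ hA => (hf hA).nullMeasurableSet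

theorem exists_terminalRuns_code [StandardBorelSpace Y] [Nonempty Y]
    (ξ : ExperimentationStrategy Ω Y) :
    ∃ F : Expanded Ω → List Y, Measurable F ∧ (∀ p, F p ∈ ξ.terminalRuns) ∧
      (∀ d ∈ ξ.terminalRuns, ∀ ω, ∃ x, F (ω, x) = d) ∧
      ∀ ω A, MeasurableSet A → ξ.terminalLaw ω A = lebesgueUnit {x | F (ω, x) ∈ A} := by
  classical
  let κ : Kernel Ω (List Y) :=
    ⟨fun ω => ξ.terminalLaw ω, measurable_playLaw ξ.measurable_round ξ.horizon⟩
  have : IsMarkovKernel κ := ⟨fun ω => isProbabilityMeasure_playLaw ξ.measurable_round ω _⟩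
  obtain ⟨f, hf, hfκ⟩ := κ.exists_measurable_map_eq_unitInterval
  obtain ⟨d₀, hd₀, -⟩ := ξ.exists_terminalRuns_extension isRun_nil
  have := ξ.measurableSet_terminalRuns.standardBorel
  have : Nonempty ξ.terminalRuns := ⟨⟨d₀, hd₀⟩⟩
  obtain ⟨C, g, hC, hg⟩ := exists_null_surjOn ξ.terminalRuns
  let f' : Expanded Ω → List Y := fun p => f p.1 p.2
  have hf' : Measurable f' := hf.comp
    (measurable_fst.prodMk ((measurable_of_nullMeasurableSpace measurable_id).comp measurable_snd))
  let C' : Set (NullMeasurableSpace unitInterval (volume : Measure unitInterval)) := C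
  have hC' : lebesgueUnit C' = 0 := (lebesgueUnit_apply C).trans hC
  let g' : NullMeasurableSpace unitInterval (volume : Measure unitInterval) → List Y :=
    fun x => if x ∈ C' then (g x : List Y) else d₀
  -- `g` is arbitrary on the null set; completeness of Lebesgue measure makes `g'` measurable, being
  -- almost everywhere constant.
  have hg' : Measurable g' := by
    refine Measurable.congr_ae (μ := lebesgueUnit) (f := fun _ => d₀) measurable_const ?_
    have : ∀ᵐ x ∂lebesgueUnit, x ∉ C' := measure_eq_zero_iff_ae_notMem.1 hC'
    filter_upwards [this] with x hx
    simp [g', hx]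
  have hmC' : MeasurableSet C' := measurableSet_of_null hC'
  -- On the null set all terminal runs are enumerated, in the same way for every state. Elsewhere
  -- `f'` realizes the terminal law, and its exceptional values are replaced by `d₀`.
  let F : Expanded Ω → List Y := fun p =>
    if p.2 ∈ C' then g' p.2 else if f' p ∈ ξ.terminalRuns then f' p else d₀
  refine ⟨F, ?_, ?_, ?_, ?_⟩
  · exact Measurable.ite (measurable_snd hmC') (hg'.comp measurable_snd)
      (Measurable.ite (hf' ξ.measurableSet_terminalRuns) hf' measurable_const)
  · intro p
    simp only [F, g']
    split_ifs with h1 h2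
    · exact (g p.2).2
    · exact h2
    · exact hd₀
  · intro d hd ω
    obtain ⟨x, hx, hgx⟩ := hg ⟨d, hd⟩
    refine ⟨x, ?_⟩
    have hx' : (x : NullMeasurableSpace unitInterval (volume : Measure unitInterval)) ∈ C' := hx
    exact (if_pos hx').trans ((if_pos hx').trans (congrArg Subtype.val hgx))
  · intro ω A hA
    have hfω : Measurable (f ω) := hf.comp measurable_prodMk_left
    have hκ : ξ.terminalLaw ω = (volume : Measure unitInterval).map (f ω) := (hfκ ω).symm
    have hae : ∀ᵐ x ∂(volume : Measure unitInterval), f ω x ∈ ξ.terminalRuns := by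
      have h := ξ.ae_terminalLaw ω
      rw [hκ] at h
      exact ae_of_ae_map hfω.aemeasurable h
    have hCae : ∀ᵐ x ∂(volume : Measure unitInterval), x ∉ C :=
      measure_eq_zero_iff_ae_notMem.1 hC
    rw [hκ, Measure.map_apply hfω hA]
    refine Eq.trans ?_ (lebesgueUnit_apply _).symm
    refine measure_congr ?_
    filter_upwards [hae, hCae] with x hx hxC
    have hxC' : (x : NullMeasurableSpace unitInterval (volume : Measure unitInterval)) ∉ C' := hxC
    have hFx : F (ω, x) = f ω x := (if_neg hxC').trans (if_pos hx)
    change (f ω x ∈ A) = (F (ω, x) ∈ A)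
    rw [hFx]

theorem exists_sameDisclosure_of_strategy [StandardBorelSpace Y] [Nontrivial Y] [Nonempty Ω]
    (ξ : ExperimentationStrategy Ω Y) : ∃ ψ : SignalSequence Ω, SameDisclosure ξ ψ := by
  obtain ⟨F, hF, hterm, hsurj, hlaw⟩ := exists_terminalRuns_code ξ
  obtain ⟨hinj, ψ, hlast, hmsg⟩ := exists_signalSequence_of_code F hF ξ.horizon
    (fun p => ξ.length_le_of_isRun (hterm p).1) {l | ξ.next (historyOf ξ.next l) = none}
    (ExperimentationStrategy.measurableSet_stop ξ) (fun p => (hterm p).2)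
    (fun p a ha hs => (hterm p).1.eq_of_prefix ha hs) <| by
      intro p a ha hs
      -- Any two outcomes of the next experiment lead to terminal runs, and both are attained by `F`
      -- whatever their probability.
      obtain ⟨y₁, y₂, hy⟩ := exists_pair_ne Y
      have hrun := (hterm p).1.of_prefix ha
      obtain ⟨d₁, hd₁, h₁⟩ :=
        ξ.exists_terminalRuns_extension (isRun_concat (y := y₁) |>.2 ⟨hrun, hs⟩)
      obtain ⟨d₂, hd₂, h₂⟩ :=
        ξ.exists_terminalRuns_extension (isRun_concat (y := y₂) |>.2 ⟨hrun, hs⟩)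
      obtain ⟨x₁, hx₁⟩ := hsurj d₁ hd₁ (Classical.arbitrary Ω)
      obtain ⟨x₂, hx₂⟩ := hsurj d₂ hd₂ (Classical.arbitrary Ω)
      exact ⟨_, _, y₁, y₂, hy, hx₁ ▸ h₁, hx₂ ▸ h₂⟩
  exact ⟨ψ, sameDisclosure_of_code ξ ψ F hF (fun p => (hterm p).1) (fun p => (hterm p).2)
    hlast hmsg hinj hlaw⟩

end Code

/-! ### From a code to a strategy, by disintegration. -/

section StrategyOfCode

variable {Ω Y : Type*} [MeasurableSpace Ω] [MeasurableSpace Y]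

instance isProbabilityMeasure_lebesgueUnit : IsProbabilityMeasure lebesgueUnit :=
  ⟨(lebesgueUnit_apply Set.univ).trans measure_univ⟩

/-- The joint law, given the state `ω` and `k`, of the first `k` entries of the code and of the
entry which follows them. -/
def codeKernel (F : Expanded Ω → List Y) (y : Y) : Kernel (Ω × ℕ) (List Y × Y) :=
  (Kernel.id ×ₖ Kernel.const (Ω × ℕ) lebesgueUnit).map
    fun q => ((F (q.1.1, q.2)).take q.1.2, (F (q.1.1, q.2)).getD q.1.2 y)

theorem measurable_take_getD {F : Expanded Ω → List Y} (hF : Measurable F) (y : Y) :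
    Measurable fun q : (Ω × ℕ) × NullMeasurableSpace unitInterval (volume : Measure unitInterval) =>
      ((F (q.1.1, q.2)).take q.1.2, (F (q.1.1, q.2)).getD q.1.2 y) := by
  have h : Measurable fun r : List Y × ℕ => (r.1.take r.2, r.1.getD r.2 y) :=
    measurable_from_prod_countable_left fun k =>
      (List.measurable_take k).prodMk (List.measurable_getD k y)
  exact h.comp ((hF.comp ((measurable_fst.comp measurable_fst).prodMk measurable_snd)).prodMk
    (measurable_snd.comp measurable_fst))

theorem isMarkovKernel_codeKernel {F : Expanded Ω → List Y} (hF : Measurable F) (y : Y) :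
    IsMarkovKernel (codeKernel F y) :=
  Kernel.IsMarkovKernel.map _ (measurable_take_getD hF y)

theorem codeKernel_apply {F : Expanded Ω → List Y} (hF : Measurable F) (y : Y) (ω : Ω) (k : ℕ)
    {B : Set (List Y × Y)} (hB : MeasurableSet B) :
    codeKernel F y (ω, k) B =
      lebesgueUnit {x | ((F (ω, x)).take k, (F (ω, x)).getD k y) ∈ B} := by
  have hm := measurable_take_getD hF y
  rw [codeKernel, Kernel.map_apply' _ hm _ hB, Kernel.prod_apply, Kernel.id_apply,
    Kernel.const_apply, Measure.dirac_prod, Measure.map_apply measurable_prodMk_left (hm hB)]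
  rfl

/-- Drawing the entries one at a time from their conditional laws reproduces the law of the code.
`hext` and `hlen` make the stopping rule consistent also on lists that are prefixes of no code. -/
theorem exists_strategy_of_code [StandardBorelSpace Y] [Nonempty Y] (F : Expanded Ω → List Y)
    (hF : Measurable F) (T : ℕ) (S : Set (List Y)) (hS : MeasurableSet S) (hhalt : ∀ p, F p ∈ S)
    (hprefix : ∀ p a, a <+: F p → a ∈ S → a = F p) (hext : ∀ l y, l ∈ S → l ++ [y] ∈ S)
    (hlen : ∀ l : List Y, T ≤ l.length → l ∈ S) :
    ∃ ξ : ExperimentationStrategy Ω Y, (∀ p, IsRun ξ.next (F p)) ∧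
      (∀ p, ξ.next (historyOf ξ.next (F p)) = none) ∧
      ∀ ω A, MeasurableSet A → ξ.terminalLaw ω A = lebesgueUnit {x | F (ω, x) ∈ A} := by
  classical
  let y₀ : Y := Classical.arbitrary Y
  have hκ := isMarkovKernel_codeKernel hF y₀
  let κ := codeKernel F y₀
  let c : Kernel ((Ω × ℕ) × List Y) Y := κ.condKernel
  let g : Ω × List Y → (Ω × ℕ) × List Y := fun p => ((p.1, p.2.length), p.2)
  have hg : Measurable g := (measurable_fst.prodMk
    (List.measurable_length.comp measurable_snd)).prodMk measurable_snd
  let exper : List Y → Experiment Ω Y := fun l =>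
    ⟨c.comap (fun ω => g (ω, l)) (hg.comp measurable_prodMk_right), inferInstance⟩
  let next : History Ω Y → Option (Experiment Ω Y) := fun h =>
    if h.outcomes ∈ S then none else some (exper h.outcomes)
  -- Outcomes after stopping are not recorded, so for `l ∈ S` the recorded list may be shorter than
  -- `l`; it still lies in `S`.
  have hout : ∀ l, (l ∈ S → (historyOf next l).outcomes ∈ S) ∧
      (l ∉ S → (historyOf next l).outcomes = l) := by
    intro l
    induction l using List.reverseRecOn with
    | nil => exact ⟨id, fun _ => rfl⟩
    | append_singleton l y ih =>
      by_cases hl : l ∈ S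
      · have h : next (historyOf next l) = none := if_pos (ih.1 hl)
        rw [historyOf_concat, h]
        exact ⟨fun _ => ih.1 hl, fun h => absurd (hext l y hl) h⟩
      · have h : next (historyOf next l) ≠ none := by simp [next, ih.2 hl, hl]
        obtain ⟨e, -, he⟩ := historyOf_concat_of_ne_none h y
        have : (historyOf next (l ++ [y])).outcomes = l ++ [y] := by
          rw [he, History.outcomes, List.map_append]
          exact congrArg (· ++ [y]) (ih.2 hl)
        rw [this]
        exact ⟨id, fun _ => rfl⟩
  have hnone : ∀ l, l ∈ S → next (historyOf next l) = none := fun l hl => if_pos ((hout l).1 hl)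
  have hsome : ∀ l, l ∉ S → next (historyOf next l) = some (exper l) := by
    intro l hl
    simp only [next, (hout l).2 hl, if_neg hl]
  have hiff : ∀ l, next (historyOf next l) = none ↔ l ∈ S := by
    intro l
    by_cases hl : l ∈ S
    · simp [hl, hnone l hl]
    · simp [hl, hsome l hl]
  have hround : Measurable fun p : Ω × List Y => roundLaw next p.1 p.2 := by
    have : (fun p : Ω × List Y => roundLaw next p.1 p.2) = fun p =>
        if p.2 ∈ S then Measure.dirac p.2 else (c (g p)).map fun y => p.2 ++ [y] := by
      funext p
      split_ifs with hp
      · exact roundLaw_of_eq_none (hnone _ hp)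
      · exact roundLaw_of_eq_some (hsome _ hp)
    rw [this]
    refine Measurable.ite (measurable_snd hS) (Measure.measurable_dirac.comp measurable_snd) ?_
    refine Measure.measurable_of_measurable_coe _ fun A hA => ?_
    simp only [Measure.map_apply (measurable_concat_right _) hA]
    have hm : Measurable fun q : (Ω × List Y) × Y => q.1.2 ++ [q.2] :=
      List.measurable_concat.comp ((measurable_snd.comp measurable_fst).prodMk measurable_snd)
    exact Kernel.measurable_kernel_prodMk_left (κ := c.comap g hg) (hm hA)
  let ξ : ExperimentationStrategy Ω Y :=
    { next := next
      horizon := T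
      stops := fun l hl => hnone l (hlen l hl)
      measurableSet_stop := by
        rw [show {l | next (historyOf next l) = none} = S from Set.ext hiff]
        exact hS
      measurable_round := hround }
  have htake : ∀ n p, ((F p).take n ∈ S → (F p).take n = F p) ∧
      ((F p).take n ∉ S → n < (F p).length) := by
    intro n p
    refine ⟨hprefix p _ (List.take_prefix _ _), fun h => ?_⟩
    by_contra! hle
    rw [List.take_of_length_le hle] at h
    exact h (hhalt p)
  have hplay : ∀ n ω A, MeasurableSet A →
      playLaw next ω n A = lebesgueUnit {x | (F (ω, x)).take n ∈ A} := by
    intro n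
    induction n with
    | zero =>
      intro ω A hA
      rw [playLaw, Measure.dirac_apply' _ hA]
      by_cases h : [] ∈ A <;> simp [h]
    | succ n ih =>
      intro ω A hA
      have hω : Measurable fun x => (F (ω, x)).take n :=
        (List.measurable_take n).comp (hF.comp measurable_prodMk_left)
      have hmap : playLaw next ω n = lebesgueUnit.map fun x => (F (ω, x)).take n := by
        ext B hB
        rw [ih ω B hB, Measure.map_apply hω hB]
        rfl
      have hfst : κ.fst (ω, n) = playLaw next ω n := by
        ext B hB
        rw [Kernel.fst_apply' _ _ hB, ih ω B hB]
        exact codeKernel_apply hF y₀ ω n (measurable_fst hB)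
      -- The event that the list is in `A` after one more round. On `S` the second coordinate,
      -- possibly the padding value `y₀`, is ignored.
      let B : Set (List Y × Y) := {r | if r.1 ∈ S then r.1 ∈ A else r.1 ++ [r.2] ∈ A}
      have hB : MeasurableSet B := by
        have : B = (Prod.fst ⁻¹' S ∩ Prod.fst ⁻¹' A) ∪
            (Prod.fst ⁻¹' Sᶜ ∩ (fun r => r.1 ++ [r.2]) ⁻¹' A) := by
          ext r
          by_cases h : r.1 ∈ S <;> simp [B, h]
        rw [this]
        exact ((measurable_fst hS).inter (measurable_fst hA)).union
          ((measurable_fst hS.compl).inter (List.measurable_concat hA))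
      -- The prescribed experiment conditions at index `l.length`; this identifies it with the round
      -- number `n`.
      have hae : ∀ᵐ l ∂playLaw next ω n, l ∉ S → l.length = n := by
        rw [hmap, ae_map_iff hω.aemeasurable]
        · refine Filter.Eventually.of_forall fun x hx => ?_
          simpa using ((htake n (ω, x)).2 hx).le
        · have : {l : List Y | l ∉ S → l.length = n} = S ∪ {l | l.length = n} := by
            ext l
            simp [imp_iff_not_or]
          rw [this]
          exact hS.union (measurableSet_eq_fun List.measurable_length measurable_const)
      calc playLaw next ω (n + 1) A
          = ∫⁻ l, roundLaw next ω l A ∂playLaw next ω n := playLaw_succ_apply hround ω n hA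
        _ = ∫⁻ l, c ((ω, n), l) (Prod.mk l ⁻¹' B) ∂playLaw next ω n := by
          refine lintegral_congr_ae ?_
          filter_upwards [hae] with l hl
          by_cases h : l ∈ S
          · rw [roundLaw_of_eq_none (hnone l h), Measure.dirac_apply' _ hA]
            by_cases hlA : l ∈ A <;> simp [B, h, hlA]
          · rw [roundLaw_of_eq_some (hsome l h), Measure.map_apply (measurable_concat_right l) hA]
            have : Prod.mk l ⁻¹' B = (fun y => l ++ [y]) ⁻¹' A := by
              ext y
              simp [B, h]
            rw [this, ← hl h]
            rfl
        _ = (κ.fst ⊗ₖ c) (ω, n) B := by rw [Kernel.compProd_apply hB, hfst]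
        _ = κ (ω, n) B := by rw [Kernel.IsCondKernel.disintegrate]
        _ = lebesgueUnit {x | (F (ω, x)).take (n + 1) ∈ A} := by
          rw [codeKernel_apply hF y₀ ω n hB]
          congr 1
          ext x
          have hx := htake n (ω, x)
          by_cases h : (F (ω, x)).take n ∈ S
          · have hle : (F (ω, x)).length ≤ n := List.take_eq_self_iff _ |>.1 (hx.1 h)
            have hFS := hhalt (ω, x)
            simp [B, List.take_of_length_le hle, List.take_of_length_le (hle.trans n.le_succ), hFS]
          · have hlt := hx.2 h
            simp [B, h, hlt, List.take_append_getElem]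
  refine ⟨ξ, fun p a ha hne => ?_, fun p => hnone _ (hhalt p), fun ω A hA => ?_⟩
  · exact fun h => hne (hprefix p a ha ((hiff a).1 h))
  · have hT : ∀ p, (F p).take T = F p := by
      intro p
      rcases le_total T (F p).length with h | h
      · exact (htake T p).1 (hlen _ (by simp [h]))
      · exact List.take_of_length_le h
    have := hplay T ω A hA
    simp only [hT] at this
    exact this

end StrategyOfCode

/-! ### Coding nested partitions by their labels. -/

section LabelCode

/-- The level set of `q` through `p`. -/
def labelCell {X : Type*} (q : X → ℝ) (p : X) : Set X := {p' | q p' = q p}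

theorem labelCell_eq_iff {X : Type*} {q : X → ℝ} {p p' : X} :
    labelCell q p' = labelCell q p ↔ q p' = q p := by
  refine ⟨fun h => ?_, fun h => by simp only [labelCell, h]⟩
  have : p' ∈ labelCell q p := h ▸ (rfl : p' ∈ labelCell q p')
  exact this

/-- The list of the labels `(i, q i p)`, `1 ≤ i ≤ n`, for those `i` whose level set through `p`
differs from the preceding one, as recorded by the sets `B i`. -/
def labelCode {X Y : Type*} (enc : ℕ × ℝ → Y) (q : ℕ → X → ℝ) (B : ℕ → Set ℝ) : ℕ → X → List Y
  | 0, _ => []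
  | n + 1, p =>
    open Classical in
    if q n p ∈ B n then labelCode enc q B n p
    else labelCode enc q B n p ++ [enc (n + 1, q (n + 1) p)]

variable {X Y : Type*} {enc : ℕ × ℝ → Y} {q : ℕ → X → ℝ} {B : ℕ → Set ℝ}

theorem labelCode_succ_of_mem {n : ℕ} {p : X} (h : q n p ∈ B n) :
    labelCode enc q B (n + 1) p = labelCode enc q B n p := if_pos h

theorem labelCode_succ_of_notMem {n : ℕ} {p : X} (h : q n p ∉ B n) :
    labelCode enc q B (n + 1) p = labelCode enc q B n p ++ [enc (n + 1, q (n + 1) p)] := if_neg h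

theorem labelCode_length_le (n : ℕ) (p : X) : (labelCode enc q B n p).length ≤ n := by
  induction n with
  | zero => exact le_rfl
  | succ n ih =>
    by_cases h : q n p ∈ B n
    · rw [labelCode_succ_of_mem h]; omega
    · rw [labelCode_succ_of_notMem h]; simpa using ih

theorem prefix_labelCode_iff {n : ℕ} {p : X} {a : List Y} :
    a <+: labelCode enc q B n p ↔ ∃ i ≤ n, labelCode enc q B i p = a := by
  induction n with
  | zero => simp [labelCode, eq_comm]
  | succ n ih =>
    have hsplit : (∃ i ≤ n + 1, labelCode enc q B i p = a) ↔
        labelCode enc q B (n + 1) p = a ∨ ∃ i ≤ n, labelCode enc q B i p = a := by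
      constructor
      · rintro ⟨i, hi, h⟩
        rcases Nat.le_succ_iff.1 hi with hi | rfl
        · exact Or.inr ⟨i, hi, h⟩
        · exact Or.inl h
      · rintro (h | ⟨i, hi, h⟩)
        · exact ⟨n + 1, le_rfl, h⟩
        · exact ⟨i, by omega, h⟩
    rw [hsplit, ← ih]
    by_cases h : q n p ∈ B n
    · rw [labelCode_succ_of_mem h]
      exact ⟨Or.inr, fun h' => h'.elim (fun e => e ▸ List.prefix_rfl) id⟩
    · rw [labelCode_succ_of_notMem h, List.prefix_concat_iff, @eq_comm _ a]

/-- Each entry carries its level, so it can be interpreted without knowing its position in the list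
or which levels were skipped. -/
theorem label_of_mem_labelCode {dec : Y → ℕ × ℝ} (hdec : ∀ r, dec (enc r) = r) {n : ℕ} {p : X}
    {y : Y} (hy : y ∈ labelCode enc q B n p) : q (dec y).1 p = (dec y).2 := by
  induction n with
  | zero => simp [labelCode] at hy
  | succ n ih =>
    by_cases h : q n p ∈ B n
    · rw [labelCode_succ_of_mem h] at hy; exact ih hy
    · rw [labelCode_succ_of_notMem h, List.mem_append, List.mem_singleton] at hy
      rcases hy with hy | rfl
      · exact ih hy
      · rw [hdec]

variable (hanti : ∀ i p, labelCell (q (i + 1)) p ⊆ labelCell (q i) p)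
include hanti

theorem labelCell_anti {i j : ℕ} (h : i ≤ j) (p : X) :
    labelCell (q j) p ⊆ labelCell (q i) p := by
  induction j, h using Nat.le_induction with
  | base => exact subset_rfl
  | succ j _ ih => exact (hanti j p).trans ih

theorem labelCode_congr {i : ℕ} {p p' : X} (h : p' ∈ labelCell (q i) p) :
    labelCode enc q B i p' = labelCode enc q B i p := by
  induction i with
  | zero => rfl
  | succ i ih =>
    have hi := hanti i p h
    have h1 : q (i + 1) p' = q (i + 1) p := h
    have h0 : q i p' = q i p := hi
    by_cases hb : q i p ∈ B i
    · rw [labelCode_succ_of_mem hb, labelCode_succ_of_mem (by rwa [h0]), ih hi]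
    · rw [labelCode_succ_of_notMem hb, labelCode_succ_of_notMem (by rwa [h0]), ih hi, h1]

variable (hB : ∀ i p, q i p ∈ B i ↔ labelCell (q i) p = labelCell (q (i + 1)) p)
include hB

/-- The intermediate cells are squeezed between two equal ones, so no entry is added between the
levels. -/
theorem labelCode_eq_of_labelCell_eq {i j : ℕ} (hij : i ≤ j) {p : X}
    (h : labelCell (q i) p = labelCell (q j) p) :
    labelCode enc q B i p = labelCode enc q B j p := by
  induction j, hij using Nat.le_induction with
  | base => rfl
  | succ j hij ih =>
    have h1 := hanti j p
    have h2 := labelCell_anti hanti hij p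
    have h3 : labelCell (q i) p = labelCell (q j) p :=
      Set.Subset.antisymm (h.subset.trans h1) h2
    rw [ih h3, labelCode_succ_of_mem ((hB j p).2 (h3.symm.trans h))]

/-- At each level up to `i` the cell of `p` either repeats the previous one or its label is an entry
of the prefix, which the code of `p'` contains as well. Conversely, points of one cell share all
labels up to that level. -/
theorem codeCylinder_labelCode {dec : Y → ℕ × ℝ} (hdec : ∀ r, dec (enc r) = r)
    (h0 : ∀ p p', q 0 p = q 0 p') {i t : ℕ} (hit : i ≤ t) (p : X) :
    codeCylinder (labelCode enc q B t) (labelCode enc q B i p) = labelCell (q i) p := by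
  ext p'
  constructor
  · intro hp'
    have key : ∀ k ≤ i, p' ∈ labelCell (q k) p := by
      intro k
      induction k with
      | zero => exact fun _ => h0 p' p
      | succ k ih =>
        intro hk
        by_cases h : q k p ∈ B k
        · rw [← (hB k p).1 h]; exact ih (by omega)
        · have hpre : labelCode enc q B (k + 1) p <+: labelCode enc q B t p' :=
            (prefix_labelCode_iff.2 ⟨k + 1, hk, rfl⟩).trans hp'
          have hmem : enc (k + 1, q (k + 1) p) ∈ labelCode enc q B t p' := by
            refine hpre.subset ?_
            rw [labelCode_succ_of_notMem h]; simp
          have := label_of_mem_labelCode hdec hmem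
          rwa [hdec] at this
    exact key i le_rfl
  · intro hp'
    rw [← labelCode_congr hanti hp']
    exact prefix_labelCode_iff.2 ⟨i, hit, rfl⟩

theorem injOn_codeCylinder_labelCode {dec : Y → ℕ × ℝ} (hdec : ∀ r, dec (enc r) = r)
    (h0 : ∀ p p', q 0 p = q 0 p') (t : ℕ) (p : X) :
    Set.InjOn (codeCylinder (labelCode enc q B t)) {a | a <+: labelCode enc q B t p} := by
  intro a ha b hb hab
  obtain ⟨i, hi, rfl⟩ := prefix_labelCode_iff.1 ha
  obtain ⟨j, hj, rfl⟩ := prefix_labelCode_iff.1 hb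
  rw [codeCylinder_labelCode hanti hB hdec h0 hi, codeCylinder_labelCode hanti hB hdec h0 hj] at hab
  rcases le_total i j with h | h
  · exact labelCode_eq_of_labelCell_eq hanti hB h hab
  · exact (labelCode_eq_of_labelCell_eq hanti hB h hab.symm).symm

omit hanti in
/-- The last entry of a code determines the level set which the code describes. -/
theorem exists_last_labelCode {dec : Y → ℕ × ℝ} (hdec : ∀ r, dec (enc r) = r)
    (h0 : ∀ p, q 0 p = 0) (i : ℕ) (p : X) : ∃ k, labelCell (q k) p = labelCell (q i) p ∧
      dec ((labelCode enc q B i p).getD ((labelCode enc q B i p).length - 1) (enc (0, 0))) =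
        (k, q k p) := by
  induction i with
  | zero => exact ⟨0, rfl, by simp [labelCode, hdec, h0]⟩
  | succ i ih =>
    by_cases h : q i p ∈ B i
    · obtain ⟨k, hk, hk'⟩ := ih
      rw [labelCode_succ_of_mem h]
      exact ⟨k, hk.trans ((hB i p).1 h), hk'⟩
    · rw [labelCode_succ_of_notMem h]
      exact ⟨i + 1, rfl, by simp [hdec]⟩

omit hanti hB in
theorem measurable_labelCode [MeasurableSpace X] [MeasurableSpace Y] (henc : Measurable enc)
    (hq : ∀ i, Measurable (q i)) (hBm : ∀ i, MeasurableSet (B i)) (n : ℕ) :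
    Measurable (labelCode enc q B n) := by
  induction n with
  | zero => exact measurable_const
  | succ n ih =>
    refine Measurable.ite (hq n (hBm n)) ih ?_
    exact List.measurable_concat.comp
      (ih.prodMk (henc.comp (measurable_const.prodMk (hq (n + 1)))))

end LabelCode

/-! ### Real labels for the signals of a sequence. -/

section SignalLabels

variable {Ω : Type*} [MeasurableSpace Ω]

theorem eq_univ_of_univ_mem {α : Type*} {π : Set (Set α)} (hπ : Setoid.IsPartition π)
    (h : Set.univ ∈ π) {s : Set α} (hs : s ∈ π) : s = Set.univ := by
  obtain ⟨p, hp⟩ := Setoid.nonempty_of_mem_partition hπ hs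
  exact (hπ.2 p).unique ⟨hs, hp⟩ ⟨h, Set.mem_univ p⟩

theorem isPartition_singleton_univ {α : Type*} [Nonempty α] :
    Setoid.IsPartition ({Set.univ} : Set (Set α)) := by
  refine ⟨fun h => ?_, fun p => ⟨Set.univ, ⟨rfl, trivial⟩, fun s hs => hs.1⟩⟩
  exact Set.empty_ne_univ h

theorem SignalSequence.isPartition [Nonempty Ω] (ψ : SignalSequence Ω) :
    ∀ π ∈ ({Set.univ} :: ψ.signals : List (Set (Set (Expanded Ω)))), Setoid.IsPartition π := by
  have : Nonempty (Expanded Ω) := ⟨(Classical.arbitrary Ω, (0 : unitInterval))⟩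
  intro π hπ
  rcases List.mem_cons.1 hπ with rfl | hπ
  · exact isPartition_singleton_univ
  · exact (ψ.isSignal π hπ).1

theorem SignalSequence.isChain_cons [Nonempty Ω] (ψ : SignalSequence Ω) :
    ({Set.univ} :: ψ.signals : List (Set (Set (Expanded Ω)))).IsChain
      fun π π' => IsRefinement π' π := by
  refine ψ.refines.cons fun π hπ => ?_
  rintro _ rfl
  refine ⟨π, subset_rfl, ?_⟩
  exact (Setoid.IsPartition.sUnion_eq_univ
    (ψ.isSignal π (List.mem_of_mem_head? hπ)).1).symm

theorem SignalSequence.exists_labels [Nonempty Ω] (ψ : SignalSequence Ω) :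
    ∀ π ∈ ({Set.univ} :: ψ.signals : List (Set (Set (Expanded Ω)))),
      ∃ q : Expanded Ω → ℝ, Measurable q ∧ IsLabelling π q ∧ (π = {Set.univ} → ∀ p, q p = 0) ∧
        ∀ π' ∈ ({Set.univ} :: ψ.signals : List (Set (Set (Expanded Ω)))),
          ∃ B : Set ℝ, MeasurableSet B ∧ ∀ s ∈ π, ∀ p ∈ s, (q p ∈ B ↔ s ∈ π') := by
  intro π hπ
  by_cases huniv : π = {Set.univ}
  · subst huniv
    refine ⟨fun _ => 0, measurable_const, ?_, fun _ _ => rfl, fun π' _ => ?_⟩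
    · rintro _ rfl p _ p'
      simp
    · refine ⟨{_r | Set.univ ∈ π'}, MeasurableSet.const _, ?_⟩
      rintro _ rfl p _
      rfl
  · have hπ' : π ∈ ψ.signals := (List.mem_cons.1 hπ).resolve_left huniv
    obtain ⟨q, hq, hlab, hB⟩ := ψ.measurable_labels π hπ'
    refine ⟨q, hq, hlab, fun h => absurd h huniv, fun π' hπ'' => ?_⟩
    rcases List.mem_cons.1 hπ'' with rfl | h
    · refine ⟨{_r | Set.univ ∈ π}, MeasurableSet.const _, fun s hs p _ => ?_⟩
      simp only [Set.mem_ofPred_eq, Set.mem_singleton_iff]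
      exact ⟨fun h => eq_univ_of_univ_mem (ψ.isPartition π hπ) h hs, fun h => h ▸ hs⟩
    · exact hB π' h

omit [MeasurableSpace Ω] in
theorem eq_range_labelCell {π : Set (Set (Expanded Ω))} (hπ : Setoid.IsPartition π)
    {q : Expanded Ω → ℝ} (hq : IsLabelling π q) : π = Set.range (labelCell q) := by
  have hcell : ∀ s ∈ π, ∀ p ∈ s, s = labelCell q p := fun s hs p hp => by
    ext p'; exact hq s hs p hp p'
  ext s
  constructor
  · intro hs
    obtain ⟨p, hp⟩ := Setoid.nonempty_of_mem_partition hπ hs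
    exact ⟨p, (hcell s hs p hp).symm⟩
  · rintro ⟨p, rfl⟩
    obtain ⟨s, ⟨hs, hp⟩, -⟩ := hπ.2 p
    rwa [← hcell s hs p hp]

theorem labelCell_mem_range_iff {X : Type*} {q q' : X → ℝ} {p : X} :
    labelCell q p ∈ Set.range (labelCell q') ↔ labelCell q p = labelCell q' p := by
  refine ⟨?_, fun h => ⟨p, h.symm⟩⟩
  rintro ⟨p', h⟩
  have hp : p ∈ labelCell q' p' := h ▸ (rfl : p ∈ labelCell q p)
  rw [← h]
  exact (labelCell_eq_iff.2 hp).symm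

omit [MeasurableSpace Ω] in
theorem labelCell_subset_of_isRefinement {q q' : Expanded Ω → ℝ}
    (h : IsRefinement (Set.range (labelCell q')) (Set.range (labelCell q))) (p : Expanded Ω) :
    labelCell q' p ⊆ labelCell q p := by
  obtain ⟨P, hP, hu⟩ := h _ ⟨p, rfl⟩
  have hp : p ∈ ⋃₀ P := hu ▸ (rfl : p ∈ labelCell q p)
  obtain ⟨s, hs, hps⟩ := hp
  obtain ⟨p', rfl⟩ := hP hs
  rw [labelCell_eq_iff.2 (show q' p = q' p' from hps), hu]
  exact Set.subset_sUnion_of_mem hs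

/-- The signals of a sequence, the uninformative one first, as level sets of real functions. -/
theorem SignalSequence.exists_labelling_sequence [Nonempty Ω] (ψ : SignalSequence Ω) :
    ∃ (t : ℕ) (q : ℕ → Expanded Ω → ℝ), (∀ i, Measurable (q i)) ∧ (∀ p, q 0 p = 0) ∧
      (∀ i p, labelCell (q (i + 1)) p ⊆ labelCell (q i) p) ∧
      (∀ i j, ∃ B : Set ℝ, MeasurableSet B ∧
        ∀ p, (q i p ∈ B ↔ labelCell (q i) p = labelCell (q j) p)) ∧
      ψ.last = Set.range (labelCell (q t)) ∧
      ∀ π, π ∈ ({Set.univ} :: ψ.signals : List (Set (Set (Expanded Ω)))) ↔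
        ∃ i ≤ t, π = Set.range (labelCell (q i)) := by
  set L : List (Set (Set (Expanded Ω))) := {Set.univ} :: ψ.signals with hL
  have hne : L ≠ [] := List.cons_ne_nil _ _
  have hlenL : L.length = ψ.signals.length + 1 := rfl
  -- Repeating the last signal forever preserves refinement and avoids bounded indices.
  let P : ℕ → Set (Set (Expanded Ω)) := fun i => L.getD i ψ.last
  have hPlt : ∀ i (hi : i < L.length), P i = L[i] := fun i hi => List.getD_eq_getElem _ _ hi
  have hPge : ∀ i, L.length ≤ i → P i = ψ.last := fun i hi => List.getD_eq_default _ _ hi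
  have hlast : ψ.last = L.getLast hne := rfl
  have hPmem : ∀ i, P i ∈ L := by
    intro i
    rcases lt_or_ge i L.length with hi | hi
    · rw [hPlt i hi]; exact List.getElem_mem hi
    · rw [hPge i hi, hlast]; exact List.getLast_mem hne
  have hPt : P ψ.signals.length = ψ.last := by
    rw [hPlt _ (by omega), hlast, List.getLast_eq_getElem]
    rfl
  have hrefl : ∀ π : Set (Set (Expanded Ω)), IsRefinement π π := fun π s hs =>
    ⟨{s}, by simpa using hs, by simp⟩
  have hchain : ∀ i, IsRefinement (P (i + 1)) (P i) := by
    intro i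
    rcases lt_or_ge (i + 1) L.length with hi | hi
    · rw [hPlt _ hi, hPlt i (by omega)]
      exact (List.isChain_iff_getElem.1 ψ.isChain_cons) i hi
    · rw [hPge _ hi]
      have : P i = ψ.last := by
        rcases Nat.lt_or_ge i L.length with h | h
        · rw [← hPt, show i = ψ.signals.length by omega]
        · exact hPge i h
      rw [this]; exact hrefl _
  choose q hqm hlab hq0 hB using fun i => ψ.exists_labels (P i) (hPmem i)
  have hrange : ∀ i, P i = Set.range (labelCell (q i)) := fun i =>
    eq_range_labelCell (ψ.isPartition _ (hPmem i)) (hlab i)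
  refine ⟨ψ.signals.length, q, hqm, hq0 0 rfl, fun i p => ?_, fun i j => ?_, ?_, fun π => ?_⟩
  · have := hchain i
    rw [hrange, hrange] at this
    exact labelCell_subset_of_isRefinement this p
  · obtain ⟨B, hBm, hB⟩ := hB i (P j) (hPmem j)
    refine ⟨B, hBm, fun p => ?_⟩
    rw [hB (labelCell (q i) p) (by rw [hrange]; exact ⟨p, rfl⟩) p rfl, hrange j,
      labelCell_mem_range_iff]
  · rw [← hrange, hPt]
  · simp only [← hrange]
    constructor
    · intro hπ
      obtain ⟨i, hi, rfl⟩ := List.getElem_of_mem hπ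
      exact ⟨i, by omega, (hPlt i hi).symm⟩
    · rintro ⟨i, -, rfl⟩
      exact hPmem i

end SignalLabels

/-! ### From signals to a strategy, and the conclusion. -/

section StrategyOfSignals

variable {Ω Y : Type*} [MeasurableSpace Ω] [MeasurableSpace Y]

theorem exists_sameDisclosure_of_signals [StandardBorelSpace Y] [Uncountable Y] [Nonempty Ω]
    (ψ : SignalSequence Ω) : ∃ ξ : ExperimentationStrategy Ω Y, SameDisclosure ξ ψ := by
  obtain ⟨t, q, hqm, hq0, hanti, hB, hlast, hmem⟩ := ψ.exists_labelling_sequence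
  choose B hBm hB using hB
  have hunc : ¬ Countable (ℕ × ℝ) := fun h =>
    not_countable (α := ℝ) (Function.Injective.countable (f := fun r : ℝ => ((0 : ℕ), r))
      fun _ _ h => (Prod.mk.inj h).2)
  let e : ℕ × ℝ ≃ᵐ Y := PolishSpace.measurableEquivOfNotCountable hunc not_countable
  have hdec : ∀ r, e.symm (e r) = r := e.symm_apply_apply
  have h0 : ∀ p p', q 0 p = q 0 p' := fun p p' => by rw [hq0, hq0]
  have hB' : ∀ i p, q i p ∈ B i (i + 1) ↔ labelCell (q i) p = labelCell (q (i + 1)) p :=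
    fun i p => hB i (i + 1) p
  let code : ℕ → Expanded Ω → List Y := labelCode e q fun i => B i (i + 1)
  let F : Expanded Ω → List Y := code t
  have hF : Measurable F := measurable_labelCode e.measurable hqm (fun i => hBm i (i + 1)) t
  have hcyl : ∀ i ≤ t, ∀ p, codeCylinder F (code i p) = labelCell (q i) p := fun i hi p =>
    codeCylinder_labelCode hanti hB' hdec h0 hi p
  let lastLabel : List Y → ℕ × ℝ := fun l => e.symm (l.getD (l.length - 1) (e (0, 0)))
  have hlastLabel : Measurable lastLabel := by
    have h : Measurable fun r : List Y × ℕ => r.1.getD r.2 (e (0, 0)) :=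
      measurable_from_prod_countable_left fun k => List.measurable_getD k _
    exact e.symm.measurable.comp (h.comp (measurable_id.prodMk
      ((measurable_of_countable fun n : ℕ => n - 1).comp List.measurable_length)))
  -- The lists whose last label names a cell that is also a cell of the last signal. The empty list
  -- reads as `(0, 0)`, the label of the whole space.
  let S₀ : Set (List Y) := lastLabel ⁻¹' {r | r.2 ∈ B r.1 t}
  have hS₀ : MeasurableSet S₀ := by
    refine hlastLabel ?_
    have : {r : ℕ × ℝ | r.2 ∈ B r.1 t} = ⋃ i : ℕ, {i} ×ˢ B i t := by
      ext r; simp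
    rw [this]
    exact MeasurableSet.iUnion fun i => (measurableSet_singleton i).prod (hBm i t)
  have hcode : ∀ i p, code i p ∈ S₀ ↔ labelCell (q i) p = labelCell (q t) p := by
    intro i p
    obtain ⟨k, hk, hk'⟩ := exists_last_labelCode (enc := e) hB' hdec hq0 i p
    have : lastLabel (code i p) = (k, q k p) := hk'
    simp only [S₀, Set.mem_preimage, this, Set.mem_ofPred_eq]
    rw [hB, hk]
  have hcodeF : ∀ i ≤ t, ∀ p, code i p ∈ S₀ → code i p = F p := fun i hi p h =>
    labelCode_eq_of_labelCell_eq hanti hB' hi ((hcode i p).1 h)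
  have hFlen : ∀ p, (F p).length ≤ t := labelCode_length_le t
  -- Closing `S₀` under extension and adding all lists of length at least `t` bounds the number of
  -- experiments; no proper prefix of a code enters.
  let S : Set (List Y) := {l | (∃ i, l.take i ∈ S₀) ∨ t ≤ l.length}
  have hS : MeasurableSet S := by
    have : S = (⋃ i, List.take i ⁻¹' S₀) ∪ {l | t ≤ l.length} := by
      ext l; simp [S]
    rw [this]
    exact (MeasurableSet.iUnion fun i => List.measurable_take i hS₀).union
      (measurableSet_le measurable_const List.measurable_length)
  have hhalt : ∀ p, F p ∈ S := fun p => Or.inl ⟨(F p).length, by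
    rw [List.take_length]; exact (hcode t p).2 rfl⟩
  have hprefix : ∀ p a, a <+: F p → a ∈ S → a = F p := by
    rintro p a ha (⟨k, hk⟩ | hlen)
    · have hka : a.take k <+: a := List.take_prefix _ _
      obtain ⟨i, hi, h⟩ := prefix_labelCode_iff.1 (hka.trans ha)
      have h' : code i p = a.take k := h
      rw [← h'] at hk hka
      rw [hcodeF i hi p hk] at hka
      exact ha.eq_of_length_le hka.length_le
    · exact ha.eq_of_length_le ((hFlen p).trans hlen)
  have hext : ∀ l y, l ∈ S → l ++ [y] ∈ S := by
    rintro l y (⟨k, hk⟩ | hlen)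
    -- The index is capped at `l.length` so that the truncation does not reach the new entry.
    · refine Or.inl ⟨min k l.length, ?_⟩
      rw [List.take_append_of_le_length (min_le_right _ _)]
      rwa [← List.take_eq_take_min]
    · refine Or.inr ?_
      rw [List.length_append]; omega
  have hY : Nonempty Y := ⟨e (0, 0)⟩
  obtain ⟨ξ, hrun, hterm, hlaw⟩ :=
    exists_strategy_of_code F hF t S hS hhalt hprefix hext fun l h => Or.inr h
  have hcylF : ∀ p, codeCylinder F (F p) = labelCell (q t) p := fun p => hcyl t le_rfl p
  refine ⟨ξ, sameDisclosure_of_code ξ ψ F hF hrun hterm ?_ (fun p => ?_)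
    (fun p => injOn_codeCylinder_labelCode hanti hB' hdec h0 t p) hlaw⟩
  · rw [hlast]
    exact congrArg Set.range (funext fun p => (hcylF p).symm)
  · rw [hcylF]
    ext m
    simp only [SignalSequence.messages, hmem, Set.mem_ofPred_eq, Set.mem_image]
    constructor
    · rintro ⟨hsub, _, ⟨i, hi, rfl⟩, p', rfl⟩
      refine ⟨code i p, prefix_labelCode_iff.2 ⟨i, hi, rfl⟩, ?_⟩
      rw [hcyl i hi]
      exact labelCell_eq_iff.2 (hsub (rfl : p ∈ labelCell (q t) p))
    · rintro ⟨a, ha, rfl⟩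
      obtain ⟨i, hi, rfl⟩ := prefix_labelCode_iff.1 ha
      have h := hcyl i hi p
      refine ⟨?_, _, ⟨i, hi, rfl⟩, p, h.symm⟩
      exact (labelCell_anti hanti hi p).trans h.superset

end StrategyOfSignals

end

theorem proposition1 {Ω Y : Type*}
    [TopologicalSpace Ω] [CompactSpace Ω] [TopologicalSpace.MetrizableSpace Ω]
    [MeasurableSpace Ω] [BorelSpace Ω] [Nonempty Ω]
    [MeasurableSpace Y] [StandardBorelSpace Y] [Uncountable Y] :
    (∀ ξ : ExperimentationStrategy Ω Y, ∃ ψ : SignalSequence Ω, SameDisclosure ξ ψ) ∧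
    (∀ ψ : SignalSequence Ω, ∃ ξ : ExperimentationStrategy Ω Y, SameDisclosure ξ ψ) :=
  ⟨exists_sameDisclosure_of_strategy, exists_sameDisclosure_of_signals⟩
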